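/- For integers $n\ge 1$ and $k\ge 0$ let $Z_{n,k}$ be the number of increasing subsequences of length $k$ in a uniformly random permutation of $\{1,\dots,n\}$, with expectation $EZ_{n,k}$ and variance $\mathrm{Var}(Z_{n,k})$. Let $(k_n)$ be a sequence of nonnegative integers. (i) If $k_n=o(n^{2/5})$, then $$\frac{\mathrm{Var}(Z_{n,k_n})}{(EZ_{n,k_n})^2}=O\!\left(\frac{k_n^{5/2}}{n}\right)\quad\text{as }n\to\infty;$$ in particular, $\mathrm{Var}(Z_{n,k_n})=o\big((EZ_{n,k_n})^2\big)$ as $n\to\infty$. (ii) For all constants $c_1,c_2>0$ there are constants $c_3,c_4>0$, depending only on $c_1$ and $c_2$, such that if $c_1n^{2/5}\le k_n\le c_2n^{2/5}$ for all sufficiently large $n$, then $$c_3\,(EZ_{n,k_n})^2\le \mathrm{Var}(Z_{n,k_n})\le c_4\,(EZ_{n,k_n})^2\quad\text{for all sufficiently large }n.$$ (iii) If $\lim_{n\to\infty}n^{-2/5}k_n=\infty$ and $\limsup_{n\to\infty}n^{-1/2}k_n<\infty$, then $$\lim_{n\to\infty}\frac{\mathrm{Var}(Z_{n,k_n})}{(EZ_{n,k_n})^2}=\infty.$$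 -/

import Mathlib

open Filter Asymptotics MeasureTheory ProbabilityTheory

namespace IncSubseq

/-- `Z n k σ` is the number of increasing subsequences of length `k` of the permutation `σ`
(read as the word `σ 0, σ 1, …`), a subsequence being given by the `k`-set of its positions. -/
def Z (n k : ℕ) (σ : Equiv.Perm (Fin n)) : ℕ :=
  (((Finset.univ : Finset (Fin n)).powersetCard k).filter
    (fun s => ∀ i ∈ s, ∀ j ∈ s, i < j → σ i < σ j)).card

/-- Permutations of a finite set carry the discrete σ-algebra. -/
instance permMeasurableSpace (n : ℕ) : MeasurableSpace (Equiv.Perm (Fin n)) := ⊤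

instance permDiscrete (n : ℕ) : DiscreteMeasurableSpace (Equiv.Perm (Fin n)) :=
  ⟨fun _ => trivial⟩

/-- The uniform probability measure on the permutations of `n` points. -/
noncomputable def unif (n : ℕ) : Measure (Equiv.Perm (Fin n)) :=
  (PMF.uniformOfFintype (Equiv.Perm (Fin n))).toMeasure

/-- The expectation of `Z n k` under the uniform measure. -/
noncomputable def meanZ (n k : ℕ) : ℝ := ∫ σ, (Z n k σ : ℝ) ∂(unif n)

/-- The variance of `Z n k` under the uniform measure. -/
noncomputable def varZ (n k : ℕ) : ℝ := variance (fun σ => (Z n k σ : ℝ)) (unif n)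

end IncSubseq

/-!
Write the second moment of `Z n k` as a sum over pairs `(S, T)` of `k`-sets of positions. The number
of permutations increasing on both sets depends only on how `S` and `T` interleave, and sorting the
permutations by the images of `S` and `T` shows that
`∑ σ, Z n k σ ^ 2 = ∑ t, (n - (2 * k - j))! * N t ^ 2`, where `t` runs over the possible patterns of
coincidence (which ranks in `S` are matched with which ranks in `T`), `j` is the number of
coincidences, and `N t` is the number of pairs of `k`-sets with pattern `t`
(`sum_Z_sq_eq_sum_pairCount`). A pair of sets is a union together with a lattice path whose diagonal
steps are the coincidences, so `N t` is a binomial coefficient times a product of binomial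
coefficients, one for each gap of the pattern (`pairCount_eq`).

Summing the squares over all `t` with `j` coincidences gives a diagonal coefficient of
`F ^ (j + 1)`, with `F = ∑ (a + b).choose a ^ 2 * x ^ a * y ^ b`, which is equal to
`(1 - 2 * (x + y) + (x - y) ^ 2) ^ (-1 / 2)`.
The coefficients of all powers of `F` have a closed product form, `appell`. To see this, the series with
these coefficients is shown to satisfy the first-order differential equation of
`(1 - 2 * (x + y) + (x - y) ^ 2) ^ (-s / 2)`; such solutions multiply (`appell_add`). The outcome is
an exact formula (`varZ_div_meanZ_sq`):
`Var / E ^ 2 + 1 = ∑ j, overlapProb n k j * overlapGain (k - j) j`.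

Here the overlap probability is at most `(k ^ 2 / n) ^ j / j!`, and the product form, by induction
on `m = k - j`, bounds the gain by `√(j!) * k ^ (j / 2)`. So the `j`-th term is at most
`y ^ j / √(j!)` with `y = k ^ (5 / 2) / n`, and summing over `j ≥ 1` bounds the relative variance by
`2 * y` for small `y`, and by a constant for bounded `y`. In the other direction, the terms `j = 0`
and `j = 1` alone are at least `exp (-4 * k ^ 2 / n) * (1 + y / √5)`. As
`y = (k / n ^ (2 / 5)) ^ (5 / 2)`, the three regimes follow.
-/

namespace IncSubseq

/-! ### The Appell coefficients and their convolution -/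

/-- The coefficient of `x ^ m * y ^ n` in `(1 - 2 * (x + y) + (x - y) ^ 2) ^ (-s / 2)`, in the
closed form `(s)_{m+n} (β)_{m+n} / (m! n! (β)_m (β)_n)` with `β = (s + 1) / 2` and rising
factorials `(·)_n` (an Appell `F₄` coefficient). -/
noncomputable def appell (s : ℝ) (m n : ℕ) : ℝ :=
  (ascPochhammer ℝ (m + n)).eval s * (ascPochhammer ℝ (m + n)).eval ((s + 1) / 2) /
    (m.factorial * n.factorial * (ascPochhammer ℝ m).eval ((s + 1) / 2) *
      (ascPochhammer ℝ n).eval ((s + 1) / 2))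

lemma ascPochhammer_eval_ne_zero {b : ℝ} (hb : 0 < b) (n : ℕ) :
    (ascPochhammer ℝ n).eval b ≠ 0 := (ascPochhammer_pos n b hb).ne'

lemma appell_zero_zero (s : ℝ) : appell s 0 0 = 1 := by simp [appell]

lemma appell_comm (s : ℝ) (m n : ℕ) : appell s m n = appell s n m := by
  unfold appell; rw [Nat.add_comm m n]; congr 1; ring

lemma appell_succ_left {s : ℝ} (hs : 0 < s) (m n : ℕ) :
    appell s (m + 1) n = appell s m n *
      ((s + m + n) * (s + 1 + 2 * m + 2 * n) / ((m + 1) * (s + 1 + 2 * m))) := by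
  have h1 := ascPochhammer_eval_ne_zero (b := (s + 1) / 2) (by positivity) m
  have h2 := ascPochhammer_eval_ne_zero (b := (s + 1) / 2) (by positivity) n
  have h3 : (m.factorial : ℝ) ≠ 0 := by positivity
  have h4 : (n.factorial : ℝ) ≠ 0 := by positivity
  have h5 : (s + 1) / 2 + (m : ℝ) ≠ 0 := by positivity
  have h6 : s + 1 + 2 * (m : ℝ) ≠ 0 := by positivity
  have h7 : (m : ℝ) + 1 ≠ 0 := by positivity
  unfold appell
  rw [show m + 1 + n = (m + n) + 1 by ring]
  simp only [ascPochhammer_succ_eval, Nat.factorial_succ]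
  push_cast
  rw [show (s + 1) / 2 + (m : ℝ) = (s + 1 + 2 * m) / 2 by ring]
  field_simp
  ring

lemma appell_succ_right {s : ℝ} (hs : 0 < s) (m n : ℕ) :
    appell s m (n + 1) = appell s m n *
      ((s + m + n) * (s + 1 + 2 * m + 2 * n) / ((n + 1) * (s + 1 + 2 * n))) := by
  rw [appell_comm, appell_succ_left hs, appell_comm s n m]
  congr 2; ring

lemma appell_pos {s : ℝ} (hs : 0 < s) (m n : ℕ) : 0 < appell s m n := by
  have h1 := ascPochhammer_pos (m + n) ((s + 1) / 2) (by positivity)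
  have h2 := ascPochhammer_pos (m + n) s hs
  have h3 := ascPochhammer_pos m ((s + 1) / 2) (by positivity)
  have h4 := ascPochhammer_pos n ((s + 1) / 2) (by positivity)
  unfold appell; positivity

lemma appell_one (m n : ℕ) : appell 1 m n = ((m + n).choose m : ℝ) ^ 2 := by
  unfold appell
  norm_num
  rw [Nat.cast_choose ℝ (Nat.le_add_right m n), Nat.add_sub_cancel_left]
  have h3 : (m.factorial : ℝ) ≠ 0 := by positivity
  have h4 : (n.factorial : ℝ) ≠ 0 := by positivity
  field_simp

section

open PowerSeries

/-- The bivariate power series with coefficients `appell s m n`. The variable `x` is the outer `X`,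
and `y` is the variable `C X` of the coefficient ring. -/
noncomputable def appellSeries (s : ℝ) : PowerSeries (PowerSeries ℝ) :=
  PowerSeries.mk fun m => PowerSeries.mk fun n => appell s m n

/-- The polynomial `1 - 2 * (x + y) + (x - y) ^ 2` as a bivariate power series. -/
noncomputable def discr : PowerSeries (PowerSeries ℝ) :=
  1 - 2 * C X + C (X * X) - 2 * X - 2 * (X * C X) + X * X

lemma coeff_coeff_appellSeries (s : ℝ) (m n : ℕ) :
    coeff n (coeff m (appellSeries s)) = appell s m n := by
  simp [appellSeries]

lemma coeff_coeff_derivative (f : PowerSeries (PowerSeries ℝ)) (m n : ℕ) :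
    coeff n (coeff m (derivative (PowerSeries ℝ) f)) = (m + 1) * coeff n (coeff (m + 1) f) := by
  rw [coeff_derivative, mul_comm]
  have : ((m : PowerSeries ℝ) + 1) = C ((m : ℝ) + 1) := by simp
  rw [this, coeff_C_mul]


/-- The equation determines the coefficients of `e` recursively from the constant one, since the
constant coefficient of `d` is not a zero divisor. -/
lemma eq_zero_of_mul_derivative {R : Type*} [CommRing R] [IsDomain R] [CharZero R]
    {d c e : PowerSeries R} (hd : constantCoeff d ≠ 0)
    (h : d * derivative R e = c * e) (h0 : constantCoeff e = 0) : e = 0 := by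
  suffices H : ∀ n, ∀ i ≤ n, coeff i e = 0 by ext n; simpa using H n n le_rfl
  intro n
  induction n with
  | zero =>
    intro i hi
    obtain rfl : i = 0 := by lia
    simpa using h0
  | succ n ih =>
    intro i hi
    rcases Nat.lt_or_ge i (n + 1) with hlt | hge
    · exact ih i (by lia)
    obtain rfl : i = n + 1 := by lia
    have h2 := congrArg (coeff n) h
    have h3 : coeff n (c * e) = 0 := by
      rw [coeff_mul]
      refine Finset.sum_eq_zero fun p hp => ?_
      rw [ih p.2 (by have := Finset.HasAntidiagonal.mem_antidiagonal.1 hp; lia), mul_zero]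
    have h4 : coeff n (d * derivative R e) =
        constantCoeff d * (coeff (n + 1) e * ((n : R) + 1)) := by
      rw [coeff_mul, Finset.sum_eq_single (0, n)]
      · simp [coeff_derivative]
      · rintro ⟨p, q⟩ hp hne
        have hpq := Finset.HasAntidiagonal.mem_antidiagonal.1 hp
        simp only [ne_eq, Prod.mk.injEq, not_and] at hne hpq ⊢
        have hq : q + 1 ≤ n := by
          by_contra hcon
          exact hne (by lia) (by lia)
        rw [coeff_derivative, ih (q + 1) hq]
        simp
      · intro hcon
        exact absurd (Finset.HasAntidiagonal.mem_antidiagonal.2 (by simp)) hcon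
    rw [h3, h4] at h2
    have h5 : ((n : R) + 1) ≠ 0 := by exact_mod_cast n.succ_ne_zero
    simpa [hd, h5] using h2

lemma eq_of_mul_derivative {R : Type*} [CommRing R] [IsDomain R] [CharZero R]
    {d c f g : PowerSeries R} (hd : constantCoeff d ≠ 0)
    (hf : d * derivative R f = c * f) (hg : d * derivative R g = c * g)
    (h0 : constantCoeff f = constantCoeff g) : f = g := by
  refine sub_eq_zero.1 (eq_zero_of_mul_derivative (c := c) hd ?_ (by simp [h0]))
  rw [map_sub, mul_sub, mul_sub, hf, hg]

lemma mul_derivative_mul {R : Type*} [CommRing R] {d a b f g : PowerSeries R}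
    (hf : d * derivative R f = a * f) (hg : d * derivative R g = b * g) :
    d * derivative R (f * g) = (a + b) * (f * g) := by
  rw [Derivation.leibniz, smul_eq_mul, smul_eq_mul]
  linear_combination g * hf + f * hg

/-- The part of `appellSeries s` free of `x` satisfies the differential equation of
`(1 - y) ^ (-s)`. -/
lemma one_sub_X_mul_derivative {s : ℝ} (hs : 0 < s) :
    (1 - X) * derivative ℝ (PowerSeries.mk fun n => appell s 0 n) =
      C s * PowerSeries.mk fun n => appell s 0 n := by
  ext n
  rw [sub_mul, one_mul, map_sub, coeff_C_mul]
  cases n with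
  | zero =>
    simp [coeff_derivative, appell_succ_right hs]
    rw [appell_zero_zero]
    have : s + 1 ≠ 0 := by positivity
    field_simp
  | succ n =>
    have h1 : s + 1 + 2 * (n : ℝ) ≠ 0 := by positivity
    have h2 : s + 1 + 2 * ((n : ℝ) + 1) ≠ 0 := by positivity
    have h3 : (n : ℝ) + 1 ≠ 0 := by positivity
    have h4 : (n : ℝ) + 1 + 1 ≠ 0 := by positivity
    simp only [coeff_succ_X_mul, coeff_derivative, coeff_mk]
    rw [appell_succ_right hs 0 (n + 1), appell_succ_right hs 0 n]
    push_cast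
    field_simp
    ring

/-- The differential equation in `x` of `discr ^ (-s / 2)`, checked on coefficients: all terms are
rational multiples of one Appell coefficient. -/
lemma discr_mul_derivative {s : ℝ} (hs : 0 < s) :
    discr * derivative _ (appellSeries s) = C (C s) * (1 + C X - X) * appellSeries s := by
  set f := derivative _ (appellSeries s) with hf
  have hF : ∀ m n, coeff n (coeff m f) = (m + 1) * appell s (m + 1) n := fun m n => by
    rw [hf, coeff_coeff_derivative, coeff_coeff_appellSeries]
  have e1 : discr * f = f - C (C 2) * (C X * f) + C X * (C X * f) - C (C 2) * (X * f)
      - C (C 2) * (X * (C X * f)) + X * (X * f) := by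
    simp only [discr, map_ofNat, map_mul]; ring
  have e2 : C (C s) * (1 + C X - X) * appellSeries s =
      C (C s) * appellSeries s + C (C s) * (C X * appellSeries s)
        - C (C s) * (X * appellSeries s) := by ring
  rw [e1, e2]
  ext m n
  simp only [map_add, map_sub, coeff_C_mul]
  -- The shifts by `x ^ 2` and `y ^ 2` make the exponents `0` and `1` boundary cases.
  rcases m with _ | _ | m <;> rcases n with _ | _ | n <;>
    simp only [coeff_zero_X_mul, coeff_succ_X_mul, coeff_C_mul, hF, coeff_coeff_appellSeries,
      map_zero, mul_zero]
  all_goals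
    simp only [appell_succ_left hs, appell_succ_right hs]
    push_cast
    field_simp
    ring

/-- Both sides satisfy the same differential equation in `x` and agree at `x = 0`, where the same
argument applies in `y`. -/
lemma appellSeries_mul {s t : ℝ} (hs : 0 < s) (ht : 0 < t) :
    appellSeries s * appellSeries t = appellSeries (s + t) := by
  have hst : 0 < s + t := by positivity
  have : CharZero (PowerSeries ℝ) :=
    charZero_of_injective_ringHom (f := C (R := ℝ)) C_injective
  refine eq_of_mul_derivative (d := discr) ?_
    (mul_derivative_mul (discr_mul_derivative hs) (discr_mul_derivative ht)) ?_ ?_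
  · intro h
    have := congrArg constantCoeff h
    simp [discr] at this
  · rw [discr_mul_derivative hst]
    simp only [map_add]
    ring
  · have key : ∀ u, constantCoeff (appellSeries u) = PowerSeries.mk fun n => appell u 0 n := by
      intro u
      simp [appellSeries]
    rw [map_mul, key, key, key]
    refine eq_of_mul_derivative (d := 1 - X) (by simp)
      (mul_derivative_mul (one_sub_X_mul_derivative hs) (one_sub_X_mul_derivative ht)) ?_ ?_
    · rw [one_sub_X_mul_derivative hst, map_add]
    · simp [appell_zero_zero]

/-- The series for `s` and `t` multiply to the series for `s + t`, read off on coefficients. -/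
lemma appell_add {s t : ℝ} (hs : 0 < s) (ht : 0 < t) (m n : ℕ) :
    appell (s + t) m n = ∑ p ∈ Finset.HasAntidiagonal.antidiagonal m,
      ∑ q ∈ Finset.HasAntidiagonal.antidiagonal n, appell s p.1 q.1 * appell t p.2 q.2 := by
  rw [← coeff_coeff_appellSeries, ← appellSeries_mul hs ht, coeff_mul, map_sum]
  simp only [coeff_mul, coeff_coeff_appellSeries]

end

/-! ### Permutations increasing on two given sets -/

section Types

variable {α : Type*} [LinearOrder α]

/-- The number of elements of `S` below `p`. -/
def rank (S : Finset α) (p : α) : ℕ := (S.filter (· < p)).card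

lemma rank_mono (S : Finset α) : Monotone (rank S) := fun p q hpq =>
  Finset.card_le_card fun x hx => by
    simp only [Finset.mem_filter] at hx ⊢
    exact ⟨hx.1, hx.2.trans_le hpq⟩

lemma rank_lt_rank {S : Finset α} {p q : α} (hp : p ∈ S) (hpq : p < q) : rank S p < rank S q := by
  refine Finset.card_lt_card ((Finset.ssubset_iff_of_subset fun x hx => ?_).2 ⟨p, ?_, ?_⟩)
  · simp only [Finset.mem_filter] at hx ⊢
    exact ⟨hx.1, hx.2.trans hpq⟩
  · simp [hp, hpq]
  · simp

lemma rank_injOn (S : Finset α) : Set.InjOn (rank S) S := by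
  intro p hp q hq h
  rcases lt_trichotomy p q with h1 | h1 | h1
  · exact absurd h (rank_lt_rank hp h1).ne
  · exact h1
  · exact absurd h (rank_lt_rank hq h1).ne'

lemma rank_lt_card {S : Finset α} {p : α} (hp : p ∈ S) : rank S p < S.card := by
  refine Finset.card_lt_card ((Finset.ssubset_iff_of_subset (Finset.filter_subset _ _)).2
    ⟨p, hp, ?_⟩)
  simp

lemma image_rank (S : Finset α) : S.image (rank S) = Finset.range S.card := by
  refine Finset.eq_of_subset_of_card_le (fun x hx => ?_) ?_
  · obtain ⟨p, hp, rfl⟩ := Finset.mem_image.1 hx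
    exact Finset.mem_range.2 (rank_lt_card hp)
  · rw [Finset.card_image_of_injOn (rank_injOn S), Finset.card_range]

/-- How two subsets meet: the pairs (rank in `S`, rank in `T`) of their common elements. Together
with the cardinalities it determines the pair `(S, T)` up to a bijection increasing on `S` and
on `T`. -/
def overlap (S T : Finset α) : Finset (ℕ × ℕ) :=
  (S ∩ T).image fun p => (rank S p, rank T p)

lemma mem_overlap {S T : Finset α} {x : ℕ × ℕ} :
    x ∈ overlap S T ↔ ∃ p ∈ S, p ∈ T ∧ rank S p = x.1 ∧ rank T p = x.2 := by
  simp [overlap, Prod.ext_iff, and_assoc]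

/-- `f` is strictly increasing on the finite set `S`, in the form used in the definition of `Z`. -/
def IncreasingOn {β : Type*} [LinearOrder β] (f : α → β) (S : Finset α) : Prop :=
  ∀ i ∈ S, ∀ j ∈ S, i < j → f i < f j

instance {β : Type*} [LinearOrder β] (f : α → β) (S : Finset α) :
    Decidable (IncreasingOn f S) := by unfold IncreasingOn; infer_instance

lemma rank_image {β : Type*} [LinearOrder β] {f : α → β} (hf : f.Injective) {S : Finset α}
    (h : IncreasingOn f S) {p : α} (hp : p ∈ S) : rank (S.image f) (f p) = rank S p := by
  have : (S.image f).filter (· < f p) = (S.filter (· < p)).image f := by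
    ext y
    simp only [Finset.mem_filter, Finset.mem_image]
    constructor
    · rintro ⟨⟨x, hx, rfl⟩, hlt⟩
      refine ⟨x, ⟨hx, ?_⟩, rfl⟩
      rcases lt_trichotomy x p with h1 | h1 | h1
      · exact h1
      · exact absurd hlt (by simp [h1])
      · exact absurd hlt (h p hp x hx h1).not_gt
    · rintro ⟨x, ⟨hx, hlt⟩, rfl⟩
      exact ⟨⟨x, hx, rfl⟩, h x hx p hp hlt⟩
  rw [rank, this, Finset.card_image_of_injective _ hf, rank]

lemma overlap_image {β : Type*} [LinearOrder β] {f : α → β} (hf : f.Injective) {S T : Finset α}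
    (hS : IncreasingOn f S) (hT : IncreasingOn f T) :
    overlap (S.image f) (T.image f) = overlap S T := by
  rw [overlap, ← Finset.image_inter _ _ hf, Finset.image_image, overlap]
  refine Finset.image_congr fun p hp => ?_
  have hp' := Finset.mem_inter.1 (Finset.mem_coe.1 hp)
  simp only [Function.comp_apply]
  rw [rank_image hf hS hp'.1, rank_image hf hT hp'.2]

lemma exists_rank_eq {S S' : Finset α} (h : S.card = S'.card) {p : α} (hp : p ∈ S) :
    ∃ q ∈ S', rank S' q = rank S p := by
  have : rank S p ∈ S'.image (rank S') := by
    rw [image_rank, ← h]; exact Finset.mem_range.2 (rank_lt_card hp)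
  exact Finset.mem_image.1 this

lemma increasingOn_of_rank {f : α → α} {S S' : Finset α}
    (h : ∀ p ∈ S, rank S' (f p) = rank S p) : IncreasingOn f S := by
  intro i hi j hj hij
  by_contra hcon
  have := rank_mono S' (not_lt.1 hcon)
  rw [h i hi, h j hj] at this
  exact absurd (rank_lt_rank hi hij) this.not_gt

/-- Pairs of sets with equal cardinalities and overlaps are related by a permutation increasing on
both sets: matching elements of equal rank is consistent on `S ∩ T` and injective on `S ∪ T`. -/
lemma exists_perm_of_overlap_eq [Fintype α] {S T S' T' : Finset α} (hS : S.card = S'.card)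
    (hT : T.card = T'.card) (h : overlap S T = overlap S' T') :
    ∃ σ : Equiv.Perm α, IncreasingOn σ S ∧ IncreasingOn σ T ∧
      S.image σ = S' ∧ T.image σ = T' := by
  classical
  have hex : ∀ p, ∃ q, (p ∈ S → q ∈ S' ∧ rank S' q = rank S p) ∧
      (p ∈ T → q ∈ T' ∧ rank T' q = rank T p) := by
    intro p
    by_cases h1 : p ∈ S <;> by_cases h2 : p ∈ T
    · have : (rank S p, rank T p) ∈ overlap S' T' := h ▸ mem_overlap.2 ⟨p, h1, h2, rfl, rfl⟩
      obtain ⟨q, hq1, hq2, hq3, hq4⟩ := mem_overlap.1 this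
      exact ⟨q, fun _ => ⟨hq1, hq3⟩, fun _ => ⟨hq2, hq4⟩⟩
    · obtain ⟨q, hq, hq'⟩ := exists_rank_eq hS h1
      exact ⟨q, fun _ => ⟨hq, hq'⟩, fun h3 => absurd h3 h2⟩
    · obtain ⟨q, hq, hq'⟩ := exists_rank_eq hT h2
      exact ⟨q, fun h3 => absurd h3 h1, fun _ => ⟨hq, hq'⟩⟩
    · exact ⟨p, fun h3 => absurd h3 h1, fun h3 => absurd h3 h2⟩
  choose f hfS hfT using hex
  -- Injectivity across the two sets uses the reverse inclusion of overlaps.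
  have cross : ∀ p ∈ S, ∀ q ∈ T, f p = f q → p = q := by
    intro p hp q hq hpq
    have : (rank S p, rank T q) ∈ overlap S T := by
      rw [h, mem_overlap]
      exact ⟨f p, (hfS p hp).1, hpq ▸ (hfT q hq).1, (hfS p hp).2, hpq ▸ (hfT q hq).2⟩
    obtain ⟨u, hu1, hu2, hu3, hu4⟩ := mem_overlap.1 this
    rw [← rank_injOn S hu1 hp hu3, ← rank_injOn T hu2 hq hu4]
  have hinj : Set.InjOn f ((S ∪ T : Finset α) : Set α) := by
    intro p hp q hq hpq
    simp only [Finset.coe_union, Set.mem_union, Finset.mem_coe] at hp hq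
    rcases hp with hp | hp <;> rcases hq with hq | hq
    · exact rank_injOn S hp hq (by rw [← (hfS p hp).2, ← (hfS q hq).2, hpq])
    · exact cross p hp q hq hpq
    · exact (cross q hq p hp hpq.symm).symm
    · exact rank_injOn T hp hq (by rw [← (hfT p hp).2, ← (hfT q hq).2, hpq])
  obtain ⟨g, hg⟩ := Finset.exists_equiv_extend_of_card_eq (t := (Finset.univ : Finset α))
    Finset.card_univ.symm (Finset.subset_univ _) hinj
  let σ : Equiv.Perm α := g.trans (Equiv.subtypeUnivEquiv Finset.mem_univ)
  have hσS : ∀ p ∈ S, σ p = f p := fun p hp => hg p (Finset.mem_union_left _ hp)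
  have hσT : ∀ p ∈ T, σ p = f p := fun p hp => hg p (Finset.mem_union_right _ hp)
  refine ⟨σ, increasingOn_of_rank (S' := S') fun p hp => ?_,
    increasingOn_of_rank (S' := T') fun p hp => ?_, ?_, ?_⟩
  · rw [hσS p hp, (hfS p hp).2]
  · rw [hσT p hp, (hfT p hp).2]
  · refine Finset.eq_of_subset_of_card_le (fun y hy => ?_)
      (by rw [Finset.card_image_of_injective _ σ.injective, hS])
    obtain ⟨p, hp, rfl⟩ := Finset.mem_image.1 hy
    rw [hσS p hp]; exact (hfS p hp).1
  · refine Finset.eq_of_subset_of_card_le (fun y hy => ?_)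
      (by rw [Finset.card_image_of_injective _ σ.injective, hT])
    obtain ⟨p, hp, rfl⟩ := Finset.mem_image.1 hy
    rw [hσT p hp]; exact (hfT p hp).1

lemma eqOn_of_image_eq {σ τ : Equiv.Perm α} {S : Finset α} (hσ : IncreasingOn σ S)
    (hτ : IncreasingOn τ S) (h : S.image σ = S.image τ) : ∀ p ∈ S, σ p = τ p := by
  intro p hp
  refine rank_injOn (S.image σ) (Finset.mem_coe.2 (Finset.mem_image_of_mem _ hp))
    (Finset.mem_coe.2 (h ▸ Finset.mem_image_of_mem _ hp)) ?_
  rw [rank_image σ.injective hσ hp, h, rank_image τ.injective hτ hp]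

lemma card_perm_eqOn {α : Type*} [Fintype α] [DecidableEq α] (σ : Equiv.Perm α) (U : Finset α) :
    (Finset.univ.filter fun τ : Equiv.Perm α => ∀ p ∈ U, τ p = σ p).card =
      (Fintype.card α - U.card).factorial := by
  have e : {τ : Equiv.Perm α // ∀ p, ¬ p ∉ U → τ p = p} ≃
      {τ : Equiv.Perm α // ∀ p ∈ U, τ p = σ p} :=
    (Equiv.mulLeft σ).subtypeEquiv fun τ => by simp
  rw [← Fintype.card_subtype, ← Fintype.card_congr e,
    ← Fintype.card_congr (Equiv.Perm.subtypeEquivSubtypePerm (· ∉ U)), Fintype.card_perm]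
  congr 1
  simp [Fintype.card_subtype_compl]

/-- The permutations carrying `(S, T)` increasingly onto `(S', T')` are prescribed on `S ∪ T` and
free elsewhere. -/
lemma card_perm_increasingOn_image [Fintype α] {S T S' T' : Finset α} (hS : S.card = S'.card)
    (hT : T.card = T'.card) :
    (Finset.univ.filter fun σ : Equiv.Perm α => (IncreasingOn σ S ∧ IncreasingOn σ T) ∧
      S.image σ = S' ∧ T.image σ = T').card =
      if overlap S T = overlap S' T' then (Fintype.card α - (S ∪ T).card).factorial else 0 := by
  split_ifs with h
  · obtain ⟨σ, h1, h2, h3, h4⟩ := exists_perm_of_overlap_eq hS hT h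
    rw [← card_perm_eqOn σ (S ∪ T)]
    congr 1
    ext τ
    simp only [Finset.mem_filter, Finset.mem_univ, true_and]
    constructor
    · rintro ⟨⟨k1, k2⟩, k3, k4⟩ p hp
      rcases Finset.mem_union.1 hp with hp | hp
      · exact eqOn_of_image_eq k1 h1 (k3.trans h3.symm) p hp
      · exact eqOn_of_image_eq k2 h2 (k4.trans h4.symm) p hp
    · intro hτ
      have kS : ∀ p ∈ S, τ p = σ p := fun p hp => hτ p (Finset.mem_union_left _ hp)
      have kT : ∀ p ∈ T, τ p = σ p := fun p hp => hτ p (Finset.mem_union_right _ hp)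
      refine ⟨⟨?_, ?_⟩, ?_, ?_⟩
      · intro i hi j hj hij
        rw [kS i hi, kS j hj]; exact h1 i hi j hj hij
      · intro i hi j hj hij
        rw [kT i hi, kT j hj]; exact h2 i hi j hj hij
      · rw [← h3]; exact Finset.image_congr kS
      · rw [← h4]; exact Finset.image_congr kT
  · rw [Finset.card_eq_zero, Finset.filter_eq_empty_iff]
    rintro σ - ⟨⟨h1, h2⟩, rfl, rfl⟩
    exact h (overlap_image σ.injective h1 h2).symm

/-- The permutations increasing on `S` and `T`, counted by the images `(S', T')` of these sets. -/
lemma card_perm_increasingOn [Fintype α] {a b : ℕ} {S T : Finset α} (hS : S.card = a)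
    (hT : T.card = b) :
    (Finset.univ.filter fun σ : Equiv.Perm α => IncreasingOn σ S ∧ IncreasingOn σ T).card =
      ∑ x ∈ Finset.powersetCard a (Finset.univ : Finset α) ×ˢ Finset.powersetCard b Finset.univ,
        if overlap S T = overlap x.1 x.2 then (Fintype.card α - (S ∪ T).card).factorial else 0 := by
  rw [Finset.card_eq_sum_card_fiberwise (f := fun σ : Equiv.Perm α => (S.image σ, T.image σ))
    (t := Finset.powersetCard a (Finset.univ : Finset α) ×ˢ Finset.powersetCard b Finset.univ)]
  · refine Finset.sum_congr rfl fun x hx => ?_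
    simp only [Finset.mem_product, Finset.mem_powersetCard_univ] at hx
    rw [← card_perm_increasingOn_image (hS.trans hx.1.symm) (hT.trans hx.2.symm),
      Finset.filter_filter]
    simp only [Prod.ext_iff]
  · intro σ _
    simp [Finset.card_image_of_injective _ σ.injective, hS, hT]

end Types

/-! ### Counting pairs of sets with a given overlap -/

/-- The overlap of `S` and `T` below `n`, as a list with decreasing entries. As a list it can be
built up along `n`. -/
def overlapList : ℕ → Finset ℕ → Finset ℕ → List (ℕ × ℕ)
  | 0, _, _ => []
  | n + 1, S, T =>
    if n ∈ S ∧ n ∈ T then (rank S n, rank T n) :: overlapList n S T else overlapList n S T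

lemma mem_overlapList {n : ℕ} {S T : Finset ℕ} {x : ℕ × ℕ} :
    x ∈ overlapList n S T ↔ ∃ p < n, p ∈ S ∧ p ∈ T ∧ rank S p = x.1 ∧ rank T p = x.2 := by
  induction n with
  | zero => simp [overlapList]
  | succ n ih =>
    unfold overlapList
    split_ifs with h
    · rw [List.mem_cons, ih]
      constructor
      · rintro (rfl | ⟨p, hp, hp'⟩)
        · exact ⟨n, by lia, h.1, h.2, rfl, rfl⟩
        · exact ⟨p, by lia, hp'⟩
      · rintro ⟨p, hp, h1, h2, h3, h4⟩
        rcases Nat.lt_or_ge p n with hlt | hge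
        · exact Or.inr ⟨p, hlt, h1, h2, h3, h4⟩
        · obtain rfl : p = n := by lia
          exact Or.inl (Prod.ext h3.symm h4.symm)
    · rw [ih]
      constructor
      · rintro ⟨p, hp, hp'⟩
        exact ⟨p, by lia, hp'⟩
      · rintro ⟨p, hp, h1, h2, h3⟩
        refine ⟨p, ?_, h1, h2, h3⟩
        by_contra hcon
        obtain rfl : p = n := by lia
        exact h ⟨h1, h2⟩

lemma overlapList_pairwise (n : ℕ) (S T : Finset ℕ) :
    (overlapList n S T).Pairwise fun x y => y.1 < x.1 := by
  induction n with
  | zero => simp [overlapList]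
  | succ n ih =>
    unfold overlapList
    split_ifs with h
    · refine List.pairwise_cons.2 ⟨fun y hy => ?_, ih⟩
      obtain ⟨p, hp, h1, -, h3, -⟩ := mem_overlapList.1 hy
      rw [← h3]
      exact rank_lt_rank h1 hp
    · exact ih

lemma overlapList_eq_overlapList_iff {n : ℕ} {S T S' T' : Finset ℕ} (hS : S ⊆ Finset.range n)
    (hS' : S' ⊆ Finset.range n) :
    overlapList n S T = overlapList n S' T' ↔ overlap S T = overlap S' T' := by
  have key : ∀ {S T : Finset ℕ}, S ⊆ Finset.range n →
      ∀ x, x ∈ overlapList n S T ↔ x ∈ overlap S T := by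
    intro S T hS x
    rw [mem_overlapList, mem_overlap]
    constructor
    · rintro ⟨p, -, h⟩; exact ⟨p, h⟩
    · rintro ⟨p, h⟩; exact ⟨p, Finset.mem_range.1 (hS h.1), h⟩
  constructor
  · intro h
    ext x
    rw [← key hS, ← key hS', h]
  · intro h
    have : Std.Irrefl fun x y : ℕ × ℕ => y.1 < x.1 := ⟨fun x => lt_irrefl _⟩
    have : Std.Antisymm fun x y : ℕ × ℕ => y.1 < x.1 :=
      ⟨fun x y h1 h2 => absurd h1 h2.not_gt⟩
    refine (overlapList_pairwise n S T).eq_of_mem_iff (overlapList_pairwise n S' T') fun x => ?_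
    rw [key hS, key hS', h]

lemma rank_succ (S : Finset ℕ) (n : ℕ) : rank S (n + 1) = rank S n + if n ∈ S then 1 else 0 := by
  have : S.filter (· < n + 1) = S.filter (· < n) ∪ S.filter (· = n) := by
    ext x; simp only [Finset.mem_filter, Finset.mem_union]; constructor
    · rintro ⟨h1, h2⟩
      rcases Nat.lt_or_ge x n with h | h
      · exact Or.inl ⟨h1, h⟩
      · exact Or.inr ⟨h1, by lia⟩
    · rintro (⟨h1, h2⟩ | ⟨h1, h2⟩)
      · exact ⟨h1, by lia⟩
      · exact ⟨h1, by lia⟩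
  rw [rank, this, Finset.card_union_of_disjoint, rank, Finset.filter_eq']
  · split_ifs <;> simp
  · rw [Finset.disjoint_left]
    intro x h1 h2
    simp only [Finset.mem_filter] at h1 h2
    lia

lemma rank_of_subset_range {S : Finset ℕ} {n : ℕ} (h : S ⊆ Finset.range n) : rank S n = S.card := by
  rw [rank, Finset.filter_true_of_mem fun x hx => Finset.mem_range.1 (h hx)]

lemma length_overlapList (n : ℕ) (S T : Finset ℕ) :
    (overlapList n S T).length = rank (S ∩ T) n := by
  induction n with
  | zero => simp [overlapList, rank]
  | succ n ih =>
    rw [rank_succ, overlapList]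
    split_ifs with h1 h2 h2 <;> simp_all

lemma rank_insert {S : Finset ℕ} {m n : ℕ} (h : m ≤ n) : rank (insert n S) m = rank S m := by
  rw [rank, Finset.filter_insert, if_neg (by lia), rank]

lemma overlapList_insert_left {S T : Finset ℕ} {m n : ℕ} (h : m ≤ n) :
    overlapList m (insert n S) T = overlapList m S T := by
  induction m with
  | zero => rfl
  | succ m ih =>
    have : m ≠ n := by lia
    rw [overlapList, overlapList, ih (by lia), rank_insert (by lia)]
    simp [this]

lemma overlapList_insert_right {S T : Finset ℕ} {m n : ℕ} (h : m ≤ n) :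
    overlapList m S (insert n T) = overlapList m S T := by
  induction m with
  | zero => rfl
  | succ m ih =>
    have : m ≠ n := by lia
    rw [overlapList, overlapList, ih (by lia), rank_insert (by lia)]
    simp [this]

/-- The number of pairs of subsets of `{0, …, n - 1}` with cardinalities `a`, `b` and overlap
list `t`. -/
def pairCount (n a b : ℕ) (t : List (ℕ × ℕ)) : ℕ :=
  ∑ S ∈ Finset.powersetCard a (Finset.range n), ∑ T ∈ Finset.powersetCard b (Finset.range n),
    if overlapList n S T = t then 1 else 0

lemma sum_powersetCard_range_succ (a n : ℕ) (F : Finset ℕ → ℕ) :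
    ∑ S ∈ Finset.powersetCard (a + 1) (Finset.range (n + 1)), F S =
      ∑ S ∈ Finset.powersetCard (a + 1) (Finset.range n), F S +
        ∑ S ∈ Finset.powersetCard a (Finset.range n), F (insert n S) := by
  have hn : ∀ {c : ℕ} {S : Finset ℕ}, S ∈ Finset.powersetCard c (Finset.range n) → n ∉ S :=
    fun h h' => by simpa using (Finset.mem_powersetCard.1 h).1 h'
  rw [Finset.range_add_one, Finset.powersetCard_succ_insert (by simp), Finset.sum_union,
    Finset.sum_image]
  · intro S hS T hT h
    rw [← Finset.erase_insert (hn hS), ← Finset.erase_insert (hn hT)]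
    exact congrArg (fun U => Finset.erase U n) h
  · rw [Finset.disjoint_left]
    rintro S h1 h2
    obtain ⟨T, -, rfl⟩ := Finset.mem_image.1 h2
    exact hn h1 (Finset.mem_insert_self _ _)

/-- The number of lattice paths from `(0, 0)` to `(a, b)` with steps `(1, 0)`, `(0, 1)`, `(1, 1)`
whose diagonal steps start exactly at the points of `t`, listed from the last one to the first. -/
def pathCount : ℕ → ℕ → List (ℕ × ℕ) → ℕ
  | a, b, [] => (a + b).choose a
  | a, b, x :: t =>
    if x.1 < a ∧ x.2 < b then
      (a - 1 - x.1 + (b - 1 - x.2)).choose (a - 1 - x.1) * pathCount x.1 x.2 t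
    else 0

/-- The number of paths counted by `pathCount (a + 1) (b + 1) t` that end with a diagonal step. -/
def diagCount (a b : ℕ) : List (ℕ × ℕ) → ℕ
  | [] => 0
  | x :: t => if x = (a, b) then pathCount a b t else 0

lemma pathCount_succ_succ (a b : ℕ) (t : List (ℕ × ℕ)) :
    pathCount (a + 1) (b + 1) t =
      pathCount (a + 1) b t + pathCount a (b + 1) t + diagCount a b t := by
  cases t with
  | nil =>
    simp only [pathCount, diagCount]
    rw [show a + 1 + (b + 1) = (a + 1 + b) + 1 by ring, Nat.choose_succ_succ,
      show a + (b + 1) = a + 1 + b by ring]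
    ring
  | cons x t =>
    obtain ⟨c, d⟩ := x
    simp only [pathCount, diagCount, Prod.mk.injEq]
    rcases Nat.lt_trichotomy c a with hc | rfl | hc
    · rcases Nat.lt_trichotomy d b with hd | rfl | hd
      · obtain ⟨e, rfl⟩ := Nat.exists_eq_add_of_lt hc
        obtain ⟨f, rfl⟩ := Nat.exists_eq_add_of_lt hd
        rw [if_pos (by lia), if_pos (by lia), if_pos (by lia), if_neg (by lia)]
        rw [show c + e + 1 + 1 - 1 - c = e + 1 by lia, show d + f + 1 + 1 - 1 - d = f + 1 by lia,
          show d + f + 1 - 1 - d = f by lia, show c + e + 1 - 1 - c = e by lia,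
          show e + 1 + (f + 1) = (e + 1 + f) + 1 by ring, Nat.choose_succ_succ,
          show e + (f + 1) = e + 1 + f by ring]
        ring
      · rw [if_pos (by lia), if_neg (by lia), if_pos (by lia), if_neg (by lia)]
        rw [show d + 1 - 1 - d = 0 by lia]
        simp
      · rw [if_neg (by lia), if_neg (by lia), if_neg (by lia), if_neg (by lia)]
    · rcases Nat.lt_trichotomy d b with hd | rfl | hd
      · rw [if_pos (by lia), if_pos (by lia), if_neg (by lia), if_neg (by lia)]
        rw [show c + 1 - 1 - c = 0 by lia]
        simp
      · rw [if_pos (by lia), if_neg (by lia), if_neg (by lia), if_pos (by lia)]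
        rw [show c + 1 - 1 - c = 0 by lia]
        simp
      · rw [if_neg (by lia), if_neg (by lia), if_neg (by lia), if_neg (by lia)]
    · rw [if_neg (by lia), if_neg (by lia), if_neg (by lia), if_neg (by lia)]

lemma pathCount_zero_left (b : ℕ) (t : List (ℕ × ℕ)) :
    pathCount 0 b t = if t = [] then 1 else 0 := by
  cases t <;> simp [pathCount]

lemma pathCount_zero_right (a : ℕ) (t : List (ℕ × ℕ)) :
    pathCount a 0 t = if t = [] then 1 else 0 := by
  cases t <;> simp [pathCount]

lemma length_le_of_pathCount_ne_zero {a b : ℕ} {t : List (ℕ × ℕ)} (h : pathCount a b t ≠ 0) :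
    t.length ≤ a ∧ t.length ≤ b := by
  induction t generalizing a b with
  | nil => simp
  | cons x t ih =>
    rw [pathCount] at h
    split_ifs at h with hx
    · have := ih (right_ne_zero_of_mul h)
      simp only [List.length_cons]
      lia
    · exact absurd rfl h

lemma overlapList_empty_left (n : ℕ) (T : Finset ℕ) : overlapList n ∅ T = [] := by
  induction n with
  | zero => rfl
  | succ n ih => simp [overlapList, ih]

lemma overlapList_empty_right (n : ℕ) (S : Finset ℕ) : overlapList n S ∅ = [] := by
  induction n with
  | zero => rfl
  | succ n ih => simp [overlapList, ih]

lemma pairCount_zero_left (n b : ℕ) (t : List (ℕ × ℕ)) :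
    pairCount n 0 b t = n.choose b * if t = [] then 1 else 0 := by
  simp only [pairCount, Finset.powersetCard_zero, Finset.sum_singleton, overlapList_empty_left,
    Finset.sum_const, Finset.card_powersetCard, Finset.card_range, smul_eq_mul, eq_comm]

lemma pairCount_zero_right (n a : ℕ) (t : List (ℕ × ℕ)) :
    pairCount n a 0 t = n.choose a * if t = [] then 1 else 0 := by
  simp only [pairCount, Finset.powersetCard_zero, Finset.sum_singleton, overlapList_empty_right,
    Finset.sum_const, Finset.card_powersetCard, Finset.card_range, smul_eq_mul, eq_comm]

lemma pairCount_succ (n a b : ℕ) (t : List (ℕ × ℕ)) :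
    pairCount (n + 1) (a + 1) (b + 1) t =
      pairCount n (a + 1) (b + 1) t + pairCount n (a + 1) b t + pairCount n a (b + 1) t +
        (match t with
          | [] => 0
          | x :: t' => if x = (a, b) then pairCount n a b t' else 0) := by
  have hn : ∀ {c : ℕ} {S : Finset ℕ}, S ∈ Finset.powersetCard c (Finset.range n) →
      n ∉ S ∧ rank S n = c := fun h => by
    have h' := Finset.mem_powersetCard.1 h
    exact ⟨fun h'' => by simpa using h'.1 h'', by rw [rank_of_subset_range h'.1, h'.2]⟩
  unfold pairCount
  simp only [sum_powersetCard_range_succ, Finset.sum_add_distrib]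
  have e1 : ∀ c d : ℕ, ∑ S ∈ Finset.powersetCard c (Finset.range n),
      ∑ T ∈ Finset.powersetCard d (Finset.range n), (if overlapList (n + 1) S T = t then 1 else 0) =
      ∑ S ∈ Finset.powersetCard c (Finset.range n),
        ∑ T ∈ Finset.powersetCard d (Finset.range n), (if overlapList n S T = t then 1 else 0) := by
    intro c d
    refine Finset.sum_congr rfl fun S hS => Finset.sum_congr rfl fun T hT => ?_
    have : overlapList (n + 1) S T = overlapList n S T := if_neg fun h => (hn hS).1 h.1
    rw [this]
  have e2 : ∀ c d : ℕ, ∑ S ∈ Finset.powersetCard c (Finset.range n),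
      ∑ T ∈ Finset.powersetCard d (Finset.range n),
        (if overlapList (n + 1) S (insert n T) = t then 1 else 0) =
      ∑ S ∈ Finset.powersetCard c (Finset.range n),
        ∑ T ∈ Finset.powersetCard d (Finset.range n), (if overlapList n S T = t then 1 else 0) := by
    intro c d
    refine Finset.sum_congr rfl fun S hS => Finset.sum_congr rfl fun T hT => ?_
    have : overlapList (n + 1) S (insert n T) = overlapList n S (insert n T) :=
      if_neg fun h => (hn hS).1 h.1
    rw [this, overlapList_insert_right le_rfl]
  have e3 : ∀ c d : ℕ, ∑ S ∈ Finset.powersetCard c (Finset.range n),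
      ∑ T ∈ Finset.powersetCard d (Finset.range n),
        (if overlapList (n + 1) (insert n S) T = t then 1 else 0) =
      ∑ S ∈ Finset.powersetCard c (Finset.range n),
        ∑ T ∈ Finset.powersetCard d (Finset.range n), (if overlapList n S T = t then 1 else 0) := by
    intro c d
    refine Finset.sum_congr rfl fun S hS => Finset.sum_congr rfl fun T hT => ?_
    have : overlapList (n + 1) (insert n S) T = overlapList n (insert n S) T :=
      if_neg fun h => (hn hT).1 h.2
    rw [this, overlapList_insert_left le_rfl]
  have e4 : ∀ S ∈ Finset.powersetCard a (Finset.range n),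
      ∀ T ∈ Finset.powersetCard b (Finset.range n),
      overlapList (n + 1) (insert n S) (insert n T) = (a, b) :: overlapList n S T := by
    intro S hS T hT
    rw [overlapList, if_pos ⟨Finset.mem_insert_self _ _, Finset.mem_insert_self _ _⟩,
      overlapList_insert_left le_rfl, overlapList_insert_right le_rfl, rank_insert le_rfl,
      rank_insert le_rfl, (hn hS).2, (hn hT).2]
  rw [e1, e2, e3]
  have e5 : ∑ S ∈ Finset.powersetCard a (Finset.range n),
      ∑ T ∈ Finset.powersetCard b (Finset.range n),
        (if overlapList (n + 1) (insert n S) (insert n T) = t then 1 else 0) =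
      (match t with
          | [] => 0
          | x :: t' => if x = (a, b) then ∑ S ∈ Finset.powersetCard a (Finset.range n),
      ∑ T ∈ Finset.powersetCard b (Finset.range n),
        (if overlapList n S T = t' then 1 else 0) else 0) := by
    have : ∑ S ∈ Finset.powersetCard a (Finset.range n),
      ∑ T ∈ Finset.powersetCard b (Finset.range n),
        (if overlapList (n + 1) (insert n S) (insert n T) = t then 1 else 0) =
        ∑ S ∈ Finset.powersetCard a (Finset.range n),
      ∑ T ∈ Finset.powersetCard b (Finset.range n),
        (if (a, b) :: overlapList n S T = t then 1 else 0) :=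
      Finset.sum_congr rfl fun S hS => Finset.sum_congr rfl fun T hT => by rw [e4 S hS T hT]
    rw [this]
    cases t with
    | nil => simp
    | cons x t' =>
      by_cases hx : x = (a, b)
      · simp [hx]
      · simp [hx, Ne.symm hx]
  rw [e5]
  cases t with
  | nil => ring
  | cons x t' => ring

/-- A pair `(S, T)` is given by its union and by the lattice path recording, for each element of the
union, whether it lies in `S`, in `T`, or in both. Both sides satisfy the same recursion in `n`. -/
lemma pairCount_eq (n a b : ℕ) (t : List (ℕ × ℕ)) :
    pairCount n a b t = n.choose (a + b - t.length) * pathCount a b t := by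
  induction n generalizing a b t with
  | zero =>
    rcases a with _ | a
    · rw [pairCount_zero_left, pathCount_zero_left]
      split_ifs with h <;> simp [h]
    · rcases b with _ | b
      · rw [pairCount_zero_right, pathCount_zero_right]
        split_ifs with h <;> simp [h]
      · have h1 : pairCount 0 (a + 1) (b + 1) t = 0 := by
          simp [pairCount]
        rw [h1]
        by_cases h : pathCount (a + 1) (b + 1) t = 0
        · rw [h, mul_zero]
        · have := length_le_of_pathCount_ne_zero h
          rw [Nat.choose_eq_zero_of_lt (by lia), zero_mul]
  | succ n ih =>
    rcases a with _ | a
    · rw [pairCount_zero_left, pathCount_zero_left]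
      split_ifs with h <;> simp [h]
    rcases b with _ | b
    · rw [pairCount_zero_right, pathCount_zero_right]
      split_ifs with h <;> simp [h]
    rw [pairCount_succ, ih, ih, ih]
    have key := pathCount_succ_succ a b t
    by_cases h : pathCount (a + 1) (b + 1) t = 0
    · rw [h] at key
      have h1 : pathCount (a + 1) b t = 0 := by lia
      have h2 : pathCount a (b + 1) t = 0 := by lia
      have h3 : diagCount a b t = 0 := by lia
      rw [h, h1, h2]
      cases t with
      | nil => simp
      | cons x t' =>
        simp only [diagCount] at h3
        simp only [ih]
        split_ifs at h3 ⊢ with hx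
        · simp [h3]
        · simp
    · have hl := length_le_of_pathCount_ne_zero h
      have h4 : (match (generalizing := false) t with
          | [] => 0
          | x :: t' => if x = (a, b) then pairCount n a b t' else 0) =
          n.choose (a + b + 1 - t.length) * diagCount a b t := by
        cases t with
        | nil => simp [diagCount]
        | cons x t' =>
          simp only [diagCount, ih, List.length_cons]
          split_ifs with hx
          · rw [show a + b + 1 - (t'.length + 1) = a + b - t'.length by lia]
          · simp
      rw [h4, show a + 1 + (b + 1) - t.length = (a + b + 1 - t.length) + 1 by lia,
        show a + 1 + b - t.length = a + b + 1 - t.length by lia,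
        show a + (b + 1) - t.length = a + b + 1 - t.length by lia, Nat.choose_succ_succ, key]
      ring

/-! ### The first two moments -/

/-- The possible overlap lists with `j` entries of two sets of cardinalities `a` and `b`: chains of
length `j` in `{0, …, a - 1} × {0, …, b - 1}`, in decreasing order. -/
def chainLists : ℕ → ℕ → ℕ → Finset (List (ℕ × ℕ))
  | 0, _, _ => {[]}
  | j + 1, a, b => (Finset.range a ×ˢ Finset.range b).biUnion fun x =>
      (chainLists j x.1 x.2).image (List.cons x)

lemma sum_chainLists_succ {M : Type*} [AddCommMonoid M] (j a b : ℕ) (F : List (ℕ × ℕ) → M) :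
    ∑ t ∈ chainLists (j + 1) a b, F t =
      ∑ c ∈ Finset.range a, ∑ d ∈ Finset.range b, ∑ t ∈ chainLists j c d, F ((c, d) :: t) := by
  rw [chainLists, Finset.sum_biUnion, Finset.sum_product]
  · refine Finset.sum_congr rfl fun c _ => Finset.sum_congr rfl fun d _ => ?_
    exact Finset.sum_image fun s _ t _ h => (List.cons.inj h).2
  · intro x _ y _ hxy
    refine Finset.disjoint_left.2 fun t h1 h2 => hxy ?_
    obtain ⟨u, -, rfl⟩ := Finset.mem_image.1 h1
    obtain ⟨v, -, hv⟩ := Finset.mem_image.1 h2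
    exact (List.cons.inj hv).1.symm

lemma length_of_mem_chainLists {j a b : ℕ} {t : List (ℕ × ℕ)} (h : t ∈ chainLists j a b) :
    t.length = j := by
  induction j generalizing a b t with
  | zero => simp [chainLists] at h; simp [h]
  | succ j ih =>
    obtain ⟨x, -, hx⟩ := Finset.mem_biUnion.1 h
    obtain ⟨u, hu, rfl⟩ := Finset.mem_image.1 hx
    simp [ih hu]

lemma chainLists_eq_empty {j a b : ℕ} (h : a < j ∨ b < j) : chainLists j a b = ∅ := by
  induction j generalizing a b with
  | zero => lia
  | succ j ih =>
    refine Finset.eq_empty_of_forall_notMem fun t ht => ?_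
    obtain ⟨x, hx, hx'⟩ := Finset.mem_biUnion.1 ht
    simp only [Finset.mem_product, Finset.mem_range] at hx
    rw [ih (by lia)] at hx'
    simp at hx'

lemma chainLists_mono {j a b a' b' : ℕ} (ha : a ≤ a') (hb : b ≤ b') :
    chainLists j a b ⊆ chainLists j a' b' := by
  cases j with
  | zero => simp [chainLists]
  | succ j =>
    refine Finset.biUnion_subset_biUnion_of_subset_left _ (Finset.product_subset_product ?_ ?_) <;>
    simpa

lemma overlapList_mem_chainLists (n : ℕ) (S T : Finset ℕ) :
    overlapList n S T ∈ chainLists (overlapList n S T).length (rank S n) (rank T n) := by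
  induction n with
  | zero => simp [overlapList, chainLists]
  | succ n ih =>
    have hS := rank_succ S n
    have hT := rank_succ T n
    rw [overlapList]
    split_ifs with h
    · rw [if_pos h.1] at hS
      rw [if_pos h.2] at hT
      refine Finset.mem_biUnion.2 ⟨(rank S n, rank T n), ?_, Finset.mem_image_of_mem _ ih⟩
      simp [hS, hT]
    · exact chainLists_mono (by lia) (by lia) ih

/-- The sum over all prescribed sets of `j` diagonal steps of the squared number of paths. Splitting
at the last diagonal step turns it into a convolution with `appell 1`. -/
lemma sum_pathCount_sq (j a b : ℕ) :
    ∑ t ∈ chainLists j (a + j) (b + j), (pathCount (a + j) (b + j) t : ℝ) ^ 2 =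
      appell (j + 1) a b := by
  induction j generalizing a b with
  | zero => simp [chainLists, pathCount, appell_one]
  | succ j ih =>
    have hj : (0 : ℝ) < j + 1 := by positivity
    rw [sum_chainLists_succ]
    push_cast
    rw [appell_add hj one_pos,
      Finset.Nat.sum_antidiagonal_eq_sum_range_succ_mk,
      show a + (j + 1) = j + (a + 1) by ring, show b + (j + 1) = j + (b + 1) by ring,
      Finset.sum_range_add, Finset.sum_eq_zero, zero_add]
    · refine Finset.sum_congr rfl fun c hc => ?_
      rw [Finset.Nat.sum_antidiagonal_eq_sum_range_succ_mk, Finset.sum_range_add,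
        Finset.sum_eq_zero, zero_add]
      · refine Finset.sum_congr rfl fun d hd => ?_
        have hc' := Finset.mem_range.1 hc
        have hd' := Finset.mem_range.1 hd
        rw [← ih c d, Finset.sum_mul]
        rw [Nat.add_comm j c, Nat.add_comm j d]
        refine Finset.sum_congr rfl fun t _ => ?_
        rw [pathCount, if_pos (by simp only; lia), appell_one]
        rw [show j + (a + 1) - 1 - (c + j) = a - c by lia,
          show j + (b + 1) - 1 - (d + j) = b - d by lia]
        push_cast
        ring
      · intro d hd
        rw [chainLists_eq_empty (Or.inr (Finset.mem_range.1 hd)), Finset.sum_empty]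
    · intro c hc
      refine Finset.sum_eq_zero fun d _ => ?_
      rw [chainLists_eq_empty (Or.inl (Finset.mem_range.1 hc)), Finset.sum_empty]

lemma Z_eq_sum (n k : ℕ) (σ : Equiv.Perm (Fin n)) :
    Z n k σ = ∑ S ∈ Finset.powersetCard k (Finset.univ : Finset (Fin n)),
      if IncreasingOn σ S then 1 else 0 := by
  rw [Z, Finset.card_filter]
  refine Finset.sum_congr rfl fun S _ => ?_
  unfold IncreasingOn
  congr

lemma sum_powersetCard_univ_fin {M : Type*} [AddCommMonoid M] (n k : ℕ) (F : Finset ℕ → M) :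
    ∑ S ∈ Finset.powersetCard k (Finset.univ : Finset (Fin n)), F (S.map Fin.valEmbedding) =
      ∑ S ∈ Finset.powersetCard k (Finset.range n), F S := by
  have : Finset.range n = (Finset.univ : Finset (Fin n)).map Fin.valEmbedding := by
    ext x
    simp only [Finset.mem_range, Finset.mem_map, Finset.mem_univ, true_and]
    exact ⟨fun h => ⟨⟨x, h⟩, rfl⟩, by rintro ⟨y, rfl⟩; exact y.2⟩
  rw [this, Finset.powersetCard_map, Finset.sum_map]
  rfl

lemma overlap_map_val {n : ℕ} (S T : Finset (Fin n)) :
    overlap (S.map Fin.valEmbedding) (T.map Fin.valEmbedding) = overlap S T := by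
  rw [Finset.map_eq_image, Finset.map_eq_image]
  exact overlap_image Fin.valEmbedding.injective (fun _ _ _ _ h => h) (fun _ _ _ _ h => h)

/-- The second moment as a count of pairs of pairs of sets with the same overlap. -/
lemma sum_Z_sq_eq_sum_overlap (n k : ℕ) :
    ∑ σ : Equiv.Perm (Fin n), Z n k σ ^ 2 =
      ∑ S ∈ Finset.powersetCard k (Finset.range n), ∑ T ∈ Finset.powersetCard k (Finset.range n),
      ∑ S' ∈ Finset.powersetCard k (Finset.range n), ∑ T' ∈ Finset.powersetCard k (Finset.range n),
        if overlap S T = overlap S' T' then (n - (S ∪ T).card).factorial else 0 := by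
  simp only [← sum_powersetCard_univ_fin, overlap_map_val, ← Finset.map_union, Finset.card_map]
  have h1 : ∀ σ : Equiv.Perm (Fin n), Z n k σ ^ 2 =
      ∑ S ∈ Finset.powersetCard k (Finset.univ : Finset (Fin n)),
        ∑ T ∈ Finset.powersetCard k (Finset.univ : Finset (Fin n)),
          if IncreasingOn σ S ∧ IncreasingOn σ T then 1 else 0 := by
    intro σ
    rw [Z_eq_sum, sq, Finset.sum_mul_sum]
    refine Finset.sum_congr rfl fun S _ => Finset.sum_congr rfl fun T _ => ?_
    rw [ite_and]
    split_ifs <;> rfl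
  simp only [h1]
  rw [Finset.sum_comm]
  refine Finset.sum_congr rfl fun S hS => ?_
  rw [Finset.sum_comm]
  refine Finset.sum_congr rfl fun T hT => ?_
  rw [← Finset.card_filter, card_perm_increasingOn (Finset.mem_powersetCard_univ.1 hS)
    (Finset.mem_powersetCard_univ.1 hT), Finset.sum_product]
  simp

/-- The second moment, with pairs of sets grouped by their common overlap list. -/
lemma sum_Z_sq_eq_sum_pairCount (n k : ℕ) :
    ∑ σ : Equiv.Perm (Fin n), Z n k σ ^ 2 =
      ∑ j ∈ Finset.range (k + 1), ∑ t ∈ chainLists j k k,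
        (n - (2 * k - j)).factorial * pairCount n k k t ^ 2 := by
  rw [sum_Z_sq_eq_sum_overlap]
  have h1 : ∀ S ∈ Finset.powersetCard k (Finset.range n),
      ∀ T ∈ Finset.powersetCard k (Finset.range n),
      (∑ S' ∈ Finset.powersetCard k (Finset.range n), ∑ T' ∈ Finset.powersetCard k (Finset.range n),
        if overlap S T = overlap S' T' then (n - (S ∪ T).card).factorial else 0) =
      (n - (2 * k - (overlapList n S T).length)).factorial *
        pairCount n k k (overlapList n S T) := by
    intro S hS T hT
    obtain ⟨hS1, hS2⟩ := Finset.mem_powersetCard.1 hS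
    obtain ⟨hT1, hT2⟩ := Finset.mem_powersetCard.1 hT
    have hlen : (overlapList n S T).length = (S ∩ T).card := by
      rw [length_overlapList, rank_of_subset_range (Finset.inter_subset_left.trans hS1)]
    have hU : (S ∪ T).card = 2 * k - (overlapList n S T).length := by
      have := Finset.card_union_add_card_inter S T
      lia
    rw [pairCount, Finset.mul_sum, hU]
    refine Finset.sum_congr rfl fun S' hS' => ?_
    rw [Finset.mul_sum]
    refine Finset.sum_congr rfl fun T' hT' => ?_
    have := overlapList_eq_overlapList_iff (T := T') (T' := T) (Finset.mem_powersetCard.1 hS').1 hS1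
    simp only [this, mul_ite, mul_one, mul_zero, eq_comm]
  rw [Finset.sum_congr rfl fun S hS => Finset.sum_congr rfl fun T hT => h1 S hS T hT,
    ← Finset.sum_product']
  set U := (Finset.range (k + 1)).biUnion fun j => chainLists j k k with hU
  have hmaps : ∀ x ∈ Finset.powersetCard k (Finset.range n) ×ˢ
      Finset.powersetCard k (Finset.range n), overlapList n x.1 x.2 ∈ U := by
    intro x hx
    obtain ⟨hx1, hx2⟩ := Finset.mem_product.1 hx
    obtain ⟨hS1, hS2⟩ := Finset.mem_powersetCard.1 hx1
    obtain ⟨hT1, hT2⟩ := Finset.mem_powersetCard.1 hx2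
    have hmem := overlapList_mem_chainLists n x.1 x.2
    rw [rank_of_subset_range hS1, rank_of_subset_range hT1, hS2, hT2] at hmem
    refine Finset.mem_biUnion.2 ⟨_, Finset.mem_range.2 ?_, hmem⟩
    by_contra hcon
    rw [chainLists_eq_empty (by lia)] at hmem
    simp at hmem
  rw [← Finset.sum_fiberwise_of_maps_to hmaps, hU, Finset.sum_biUnion]
  · refine Finset.sum_congr rfl fun j _ => Finset.sum_congr rfl fun t ht => ?_
    have hl := length_of_mem_chainLists ht
    have : ∑ x ∈ (Finset.powersetCard k (Finset.range n) ×ˢ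
        Finset.powersetCard k (Finset.range n)).filter (fun x => overlapList n x.1 x.2 = t),
        (n - (2 * k - (overlapList n x.1 x.2).length)).factorial *
          pairCount n k k (overlapList n x.1 x.2) =
        ∑ x ∈ (Finset.powersetCard k (Finset.range n) ×ˢ
        Finset.powersetCard k (Finset.range n)).filter (fun x => overlapList n x.1 x.2 = t),
        (n - (2 * k - j)).factorial * pairCount n k k t :=
      Finset.sum_congr rfl fun x hx => by rw [(Finset.mem_filter.1 hx).2, hl]
    rw [this, Finset.sum_const, Finset.card_filter, Finset.sum_product, smul_eq_mul,
      ← pairCount]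
    ring
  · intro i _ j _ hij
    refine Finset.disjoint_left.2 fun t h1 h2 => hij ?_
    rw [← length_of_mem_chainLists h1, length_of_mem_chainLists h2]

/-- The exact second moment of `Z n k`; the index `j` is the number of common elements of two
increasing subsequences. -/
theorem sum_Z_sq (n k : ℕ) :
    ∑ σ : Equiv.Perm (Fin n), (Z n k σ : ℝ) ^ 2 =
      ∑ j ∈ Finset.range (k + 1), ((n - (2 * k - j)).factorial : ℝ) *
        (n.choose (2 * k - j) : ℝ) ^ 2 * appell (j + 1) (k - j) (k - j) := by
  have h := congrArg (Nat.cast (R := ℝ)) (sum_Z_sq_eq_sum_pairCount n k)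
  push_cast at h
  rw [h]
  refine Finset.sum_congr rfl fun j hj => ?_
  have hj' := Finset.mem_range.1 hj
  obtain ⟨m, rfl⟩ : ∃ m, k = m + j := ⟨k - j, by lia⟩
  rw [Nat.add_sub_cancel, ← sum_pathCount_sq, Finset.mul_sum]
  refine Finset.sum_congr rfl fun t ht => ?_
  rw [pairCount_eq, length_of_mem_chainLists ht, ← two_mul]
  push_cast
  ring

theorem sum_Z {n k : ℕ} (hk : k ≤ n) :
    ∑ σ : Equiv.Perm (Fin n), (Z n k σ : ℝ) = n.choose k * (n.factorial / k.factorial) := by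
  have h : ∑ σ : Equiv.Perm (Fin n), Z n k σ = n.choose k * (n.choose k * (n - k).factorial) := by
    simp only [Z_eq_sum]
    rw [Finset.sum_comm]
    have : ∀ S ∈ Finset.powersetCard k (Finset.univ : Finset (Fin n)),
        ∑ σ : Equiv.Perm (Fin n), (if IncreasingOn σ S then 1 else 0) =
          n.choose k * (n - k).factorial := by
      intro S hS
      have hc := Finset.mem_powersetCard_univ.1 hS
      have := card_perm_increasingOn hc (Finset.card_empty (α := Fin n))
      have hempty : ∀ σ : Equiv.Perm (Fin n), IncreasingOn σ (∅ : Finset (Fin n)) := by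
        simp [IncreasingOn]
      rw [← Finset.card_filter]
      simpa [hempty, overlap, hc] using this
    rw [Finset.sum_congr rfl this]
    simp
  have h' := congrArg (Nat.cast (R := ℝ)) h
  push_cast at h'
  rw [h', Nat.cast_choose ℝ hk]
  have h1 : (k.factorial : ℝ) ≠ 0 := by positivity
  have h2 : ((n - k).factorial : ℝ) ≠ 0 := by positivity
  field_simp

/-! ### The relative variance and the gain factors -/

lemma integral_unif (n : ℕ) (f : Equiv.Perm (Fin n) → ℝ) :
    ∫ σ, f σ ∂(unif n) = (∑ σ, f σ) / n.factorial := by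
  rw [unif, PMF.integral_eq_sum, Finset.sum_div]
  refine Finset.sum_congr rfl fun σ _ => ?_
  rw [PMF.uniformOfFintype_apply, Fintype.card_perm, Fintype.card_fin]
  simp [div_eq_inv_mul]

instance (n : ℕ) : IsProbabilityMeasure (unif n) := by unfold unif; infer_instance

lemma meanZ_eq {n k : ℕ} (hk : k ≤ n) : meanZ n k = n.choose k / k.factorial := by
  rw [meanZ, integral_unif, sum_Z hk]
  have : (n.factorial : ℝ) ≠ 0 := by positivity
  field_simp

lemma meanZ_pos {n k : ℕ} (hk : k ≤ n) : 0 < meanZ n k := by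
  rw [meanZ_eq hk]
  have := Nat.choose_pos hk
  positivity

lemma varZ_eq (n k : ℕ) :
    varZ n k = (∑ σ : Equiv.Perm (Fin n), (Z n k σ : ℝ) ^ 2) / n.factorial - meanZ n k ^ 2 := by
  rw [varZ, variance_eq_sub .of_discrete, ← integral_unif]
  rfl

lemma varZ_nonneg (n k : ℕ) : 0 ≤ varZ n k := variance_nonneg _ _

/-- The probability that two independent uniform `k`-subsets of an `n`-set have `j` common
elements. -/
noncomputable def overlapProb (n k j : ℕ) : ℝ :=
  (k.choose j : ℝ) * (n - k).choose (k - j) / n.choose k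

/-- The factor by which `j` common elements, with `m` further elements in each of two
`(m + j)`-sets, raise the average probability that a random permutation increases on both sets,
relative to independence. -/
noncomputable def overlapGain (m j : ℕ) : ℝ :=
  ((m + j).factorial : ℝ) ^ 2 * j.factorial * (m.factorial : ℝ) ^ 2 /
    ((2 * m + j).factorial : ℝ) ^ 2 * appell (j + 1) m m

lemma overlapProb_nonneg (n k j : ℕ) : 0 ≤ overlapProb n k j := by
  unfold overlapProb; positivity

lemma overlapGain_pos (m j : ℕ) : 0 < overlapGain m j := by
  have := appell_pos (s := (j : ℝ) + 1) (by positivity) m m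
  unfold overlapGain; positivity

/-- The relative variance is the average over the overlap of two random `k`-sets of the gain,
minus one. -/
lemma varZ_div_meanZ_sq {n k : ℕ} (hk : k ≤ n) :
    varZ n k / meanZ n k ^ 2 =
      ∑ j ∈ Finset.range (k + 1), overlapProb n k j * overlapGain (k - j) j - 1 := by
  have hm := (meanZ_pos hk).ne'
  rw [varZ_eq, sub_div, div_self (pow_ne_zero 2 hm), sum_Z_sq, Finset.sum_div, Finset.sum_div]
  congr 1
  refine Finset.sum_congr rfl fun j hj => ?_
  obtain ⟨m, rfl⟩ : ∃ m, k = m + j := ⟨k - j, by have := Finset.mem_range.1 hj; lia⟩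
  obtain ⟨r, rfl⟩ : ∃ r, n = m + j + r := ⟨n - (m + j), by lia⟩
  rw [meanZ_eq hk, overlapProb, overlapGain, Nat.add_sub_cancel, Nat.add_sub_cancel_left,
    show 2 * (m + j) - j = 2 * m + j by lia]
  rcases Nat.lt_or_ge r m with h | h
  · rw [Nat.choose_eq_zero_of_lt h, Nat.choose_eq_zero_of_lt (show m + j + r < 2 * m + j by lia)]
    simp
  · obtain ⟨l, rfl⟩ : ∃ l, r = m + l := ⟨r - m, by lia⟩
    rw [show m + j + (m + l) - (2 * m + j) = l by lia,
      Nat.cast_choose ℝ (show 2 * m + j ≤ m + j + (m + l) by lia),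
      Nat.cast_choose ℝ (show m + j ≤ m + j + (m + l) by lia),
      Nat.cast_choose ℝ (show j ≤ m + j by lia), Nat.cast_choose ℝ (show m ≤ m + l by lia),
      show m + j + (m + l) - (2 * m + j) = l by lia, Nat.add_sub_cancel_left,
      Nat.add_sub_cancel_left, Nat.add_sub_cancel]
    have f1 : ((m + j + (m + l)).factorial : ℝ) ≠ 0 := by positivity
    have f2 : ((2 * m + j).factorial : ℝ) ≠ 0 := by positivity
    have f3 : ((m + j).factorial : ℝ) ≠ 0 := by positivity
    have f4 : ((m + l).factorial : ℝ) ≠ 0 := by positivity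
    have f5 : (m.factorial : ℝ) ≠ 0 := by positivity
    have f6 : (j.factorial : ℝ) ≠ 0 := by positivity
    have f7 : (l.factorial : ℝ) ≠ 0 := by positivity
    field_simp

lemma overlapGain_succ (m j : ℕ) :
    overlapGain (m + 1) j = overlapGain m j *
      (((m : ℝ) + j + 1) ^ 2 * (4 * m + j + 2) * (4 * m + j + 4) /
        ((2 * m + j + 1) * (2 * m + j + 2) ^ 3)) := by
  have hs : (0 : ℝ) < j + 1 := by positivity
  unfold overlapGain
  rw [appell_succ_left hs, appell_succ_right hs, show m + 1 + j = (m + j) + 1 by ring,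
    show 2 * (m + 1) + j = (2 * m + j) + 1 + 1 by ring]
  simp only [Nat.factorial_succ]
  push_cast
  have f2 : ((2 * m + j).factorial : ℝ) ≠ 0 := by positivity
  have g1 : (2 * (m : ℝ) + j + 1) ≠ 0 := by positivity
  have g2 : (2 * (m : ℝ) + j + 1 + 1) ≠ 0 := by positivity
  have g3 : (j : ℝ) + 1 + 1 + 2 * m ≠ 0 := by positivity
  have g4 : (m : ℝ) + 1 ≠ 0 := by positivity
  have g5 : (2 * (m : ℝ) + j + 2) ≠ 0 := by positivity
  rw [show (2 * (m : ℝ) + j + 1 + 1) = 2 * (m : ℝ) + j + 2 by ring,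
    show (j : ℝ) + 1 + 1 + 2 * m = 2 * (m : ℝ) + j + 2 by ring]
  field_simp
  ring

lemma overlapGain_zero_left (j : ℕ) : overlapGain 0 j = j.factorial := by
  have : (j.factorial : ℝ) ≠ 0 := by positivity
  simp [overlapGain, appell_zero_zero]
  field_simp

lemma overlapGain_zero_right (m : ℕ) : overlapGain m 0 = 1 := by
  induction m with
  | zero => simp [overlapGain_zero_left]
  | succ m ih =>
    rw [overlapGain_succ, ih]
    have g1 : (2 * (m : ℝ) + 1) ≠ 0 := by positivity
    have g2 : (2 * (m : ℝ) + 2) ≠ 0 := by positivity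
    push_cast
    simp only [add_zero]
    field_simp
    ring

/-- Induction on `m`: after clearing denominators, the step compares polynomials in `m` and `j`
whose difference has nonnegative coefficients. -/
lemma overlapGain_sq_mul_le (m j : ℕ) :
    overlapGain m j ^ 2 * m.factorial ≤ j.factorial * (m + j).factorial := by
  induction m with
  | zero => simp [overlapGain_zero_left, sq]
  | succ m ih =>
    set x : ℝ := (m : ℝ) with hx
    set y : ℝ := (j : ℝ) with hy
    have hx0 : 0 ≤ x := by positivity
    have hy0 : 0 ≤ y := by positivity
    have key : ((x + y + 1) ^ 2 * (4 * x + y + 2) * (4 * x + y + 4) /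
        ((2 * x + y + 1) * (2 * x + y + 2) ^ 3)) ^ 2 * (x + 1) ≤ x + y + 1 := by
      rw [div_pow, div_mul_eq_mul_div, div_le_iff₀ (by positivity), ← sub_nonneg]
      have : 0 ≤ (x + y + 1) * ((2 * x + y + 1) ^ 2 * (2 * x + y + 2) ^ 6 -
          (x + y + 1) ^ 3 * (4 * x + y + 2) ^ 2 * (4 * x + y + 4) ^ 2 * (x + 1)) := by
        refine mul_nonneg (by positivity) ?_
        ring_nf
        positivity
      linarith
    rw [overlapGain_succ, show m + 1 + j = (m + j) + 1 by ring, Nat.factorial_succ,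
      Nat.factorial_succ]
    push_cast
    rw [← hx, ← hy]
    calc _ = (overlapGain m j ^ 2 * m.factorial) *
          (((x + y + 1) ^ 2 * (4 * x + y + 2) * (4 * x + y + 4) /
        ((2 * x + y + 1) * (2 * x + y + 2) ^ 3)) ^ 2 * (x + 1)) := by ring
      _ ≤ (j.factorial * (m + j).factorial) * (x + y + 1) :=
        mul_le_mul ih key (by positivity) (by positivity)
      _ = _ := by ring

/-- The gain is at most `√(j!) * k ^ (j / 2)` with `k = m + j`. For fixed `j` this is the true order
in `k`, which is where the exponent `5 / 2` comes from. -/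
lemma overlapGain_sq_le (m j : ℕ) :
    overlapGain m j ^ 2 ≤ j.factorial * ((m + j : ℕ) : ℝ) ^ j := by
  have h1 := overlapGain_sq_mul_le m j
  have h2 : ((m + j).factorial : ℝ) ≤ m.factorial * ((m + j : ℕ) : ℝ) ^ j := by
    rw [← Nat.factorial_mul_ascFactorial]
    exact_mod_cast Nat.mul_le_mul_left _ (Nat.ascFactorial_le_pow_add m j)
  have h3 : (0 : ℝ) < m.factorial := by positivity
  refine le_of_mul_le_mul_right (h1.trans ?_) h3
  calc (j.factorial : ℝ) * (m + j).factorial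
      ≤ j.factorial * (m.factorial * ((m + j : ℕ) : ℝ) ^ j) := by gcongr
    _ = _ := by ring

/-- Already one common element gains a factor of order `√k`, with `k = m + 1`. The shift by `5`
makes the induction on `m` go through. -/
lemma le_overlapGain_one_sq (m : ℕ) : ((m : ℝ) + 5) / 5 ≤ overlapGain m 1 ^ 2 := by
  induction m with
  | zero => simp [overlapGain_zero_left]
  | succ m ih =>
    set x : ℝ := (m : ℝ) with hx
    have hx0 : 0 ≤ x := by positivity
    have key : (x + 6) / (x + 5) ≤ ((x + 1 + 1) ^ 2 * (4 * x + 1 + 2) * (4 * x + 1 + 4) /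
        ((2 * x + 1 + 1) * (2 * x + 1 + 2) ^ 3)) ^ 2 := by
      rw [div_pow, div_le_div_iff₀ (by positivity) (by positivity), ← sub_nonneg]
      ring_nf
      positivity
    rw [overlapGain_succ]
    push_cast
    rw [← hx, mul_pow]
    calc (x + 1 + 5) / 5 = (x + 5) / 5 * ((x + 6) / (x + 5)) := by field_simp; ring
      _ ≤ _ := mul_le_mul ih key (by positivity) (by positivity)

/-! ### Bounds for the relative variance -/

lemma choose_mul_pow_le {n k : ℕ} (hk : k ≤ n) (j : ℕ) :
    k.choose j * n ^ j ≤ n.choose j * k ^ j := by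
  have h : k.descFactorial j * n ^ j ≤ n.descFactorial j * k ^ j := by
    induction j with
    | zero => simp
    | succ j ih =>
      have h1 : (k - j) * n ≤ (n - j) * k := by
        rw [Nat.sub_mul, Nat.sub_mul, Nat.mul_comm n k]
        exact Nat.sub_le_sub_left (Nat.mul_le_mul_left j hk) _
      rw [Nat.descFactorial_succ, Nat.descFactorial_succ, pow_succ, pow_succ]
      calc (k - j) * k.descFactorial j * (n ^ j * n)
          = ((k - j) * n) * (k.descFactorial j * n ^ j) := by ring
        _ ≤ ((n - j) * k) * (n.descFactorial j * k ^ j) := Nat.mul_le_mul h1 ih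
        _ = _ := by ring
  rw [Nat.descFactorial_eq_factorial_mul_choose, Nat.descFactorial_eq_factorial_mul_choose,
    mul_assoc, mul_assoc] at h
  exact Nat.le_of_mul_le_mul_left h j.factorial_pos

lemma overlapProb_le {n k j : ℕ} (hk : k ≤ n) (hn : 0 < n) (hj : j ≤ k) :
    overlapProb n k j ≤ ((k : ℝ) ^ 2 / n) ^ j / j.factorial := by
  have h1 : ((n - k).choose (k - j) : ℝ) ≤ (n - j).choose (k - j) := by
    exact_mod_cast Nat.choose_le_choose _ (by lia)
  have h2 : (n.choose k : ℝ) * k.choose j = n.choose j * (n - j).choose (k - j) := by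
    exact_mod_cast Nat.choose_mul hj
  have h3 : (k.choose j : ℝ) * (n : ℝ) ^ j ≤ n.choose j * (k : ℝ) ^ j := by
    exact_mod_cast choose_mul_pow_le hk j
  have h4 : (k.choose j : ℝ) ≤ (k : ℝ) ^ j / j.factorial := Nat.choose_le_pow_div j k
  have p1 : (0 : ℝ) < n.choose k := by exact_mod_cast Nat.choose_pos hk
  have p2 : (0 : ℝ) < n.choose j := by exact_mod_cast Nat.choose_pos (hj.trans hk)
  have p3 : (0 : ℝ) < n := by exact_mod_cast hn
  have h5 : ((n - j).choose (k - j) : ℝ) / n.choose k ≤ (k / n : ℝ) ^ j := by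
    have : ((n - j).choose (k - j) : ℝ) / n.choose k = k.choose j / n.choose j := by
      rw [div_eq_div_iff p1.ne' p2.ne']; linarith
    rw [this, div_pow, div_le_div_iff₀ p2 (by positivity)]
    linarith
  calc overlapProb n k j
      = k.choose j * (((n - k).choose (k - j) : ℝ) / n.choose k) := by rw [overlapProb]; ring
    _ ≤ ((k : ℝ) ^ j / j.factorial) * ((k / n : ℝ) ^ j) := by
        refine mul_le_mul h4 (le_trans ?_ h5) (by positivity) (by positivity)
        gcongr
    _ = _ := by rw [div_pow, div_pow]; ring

lemma overlapProb_zero_le_one {n k : ℕ} (hk : k ≤ n) : overlapProb n k 0 ≤ 1 := by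
  have p1 : (0 : ℝ) < n.choose k := by exact_mod_cast Nat.choose_pos hk
  rw [overlapProb, div_le_one p1]
  simp only [Nat.choose_zero_right, Nat.cast_one, one_mul, Nat.sub_zero]
  exact_mod_cast Nat.choose_le_choose _ (Nat.sub_le n k)

lemma exp_neg_two_mul_le {x : ℝ} (h0 : 0 ≤ x) (h1 : x ≤ 1 / 2) : Real.exp (-(2 * x)) ≤ 1 - x := by
  have h2 : 1 + 2 * x ≤ Real.exp (2 * x) := by linarith [Real.add_one_le_exp (2 * x)]
  rw [Real.exp_neg, inv_le_comm₀ (Real.exp_pos _) (by linarith)]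
  refine le_trans ?_ h2
  rw [inv_le_iff_one_le_mul₀ (by linarith)]
  nlinarith

lemma exp_le_overlapProb_zero {n k : ℕ} (hk : 4 * k ≤ n) (hn : 0 < n) :
    Real.exp (-(4 * (k : ℝ) ^ 2 / n)) ≤ overlapProb n k 0 := by
  have p3 : (0 : ℝ) < n := by exact_mod_cast hn
  have hk' : 4 * (k : ℝ) ≤ n := by exact_mod_cast hk
  have hx0 : (0 : ℝ) ≤ 2 * k / n := by positivity
  have hx1 : 2 * (k : ℝ) / n ≤ 1 / 2 := by
    rw [div_le_div_iff₀ p3 two_pos]; linarith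
  have step : ∀ i ≤ k, (1 - 2 * (k : ℝ) / n) ^ i * n.descFactorial i ≤
      (n - k).descFactorial i := by
    intro i hi
    induction i with
    | zero => simp
    | succ i ih =>
      have hi' : (i : ℝ) + 1 ≤ k := by exact_mod_cast hi
      have h1 : (1 - 2 * (k : ℝ) / n) * (n - i : ℕ) ≤ (n - k - i : ℕ) := by
        rw [Nat.cast_sub (by lia), Nat.cast_sub (by lia), Nat.cast_sub (by lia)]
        have : (k : ℝ) ≤ 2 * k / n * (n - i) := by
          rw [div_mul_eq_mul_div, le_div_iff₀ p3]
          have : (0 : ℝ) ≤ k := by positivity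
          nlinarith
        linarith
      rw [Nat.descFactorial_succ, Nat.descFactorial_succ]
      push_cast
      calc _ = ((1 - 2 * (k : ℝ) / n) * (n - i : ℕ)) *
            ((1 - 2 * (k : ℝ) / n) ^ i * n.descFactorial i) := by ring
        _ ≤ (n - k - i : ℕ) * (n - k).descFactorial i := by
          refine mul_le_mul h1 (ih (by lia)) ?_ (by positivity)
          have : (0 : ℝ) ≤ 1 - 2 * (k : ℝ) / n := by linarith
          positivity
  have h := step k le_rfl
  rw [Nat.descFactorial_eq_factorial_mul_choose, Nat.descFactorial_eq_factorial_mul_choose] at h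
  push_cast at h
  have p1 : (0 : ℝ) < n.choose k := by exact_mod_cast Nat.choose_pos (show k ≤ n by lia)
  have p4 : (0 : ℝ) < k.factorial := by positivity
  have h2 : (1 - 2 * (k : ℝ) / n) ^ k ≤ overlapProb n k 0 := by
    rw [overlapProb, le_div_iff₀ p1]
    simp only [Nat.choose_zero_right, Nat.cast_one, one_mul, Nat.sub_zero]
    refine le_of_mul_le_mul_left ?_ p4
    linarith
  refine le_trans ?_ h2
  calc Real.exp (-(4 * (k : ℝ) ^ 2 / n)) = Real.exp (-(2 * (2 * k / n))) ^ k := by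
        rw [← Real.exp_nat_mul]; congr 1; ring
    _ ≤ _ := pow_le_pow_left₀ (Real.exp_pos _).le (exp_neg_two_mul_le hx0 hx1) k

lemma mul_overlapProb_zero_le {n k : ℕ} (hk : 2 * k ≤ n) (hk0 : 0 < k) :
    (k : ℝ) ^ 2 / n * overlapProb n k 0 ≤ overlapProb n k 1 := by
  have hn : (0 : ℝ) < n := by exact_mod_cast (show 0 < n by lia)
  have p1 : (0 : ℝ) < n.choose k := by exact_mod_cast Nat.choose_pos (show k ≤ n by lia)
  have h := Nat.choose_succ_right_eq (n - k) (k - 1)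
  rw [Nat.sub_add_cancel hk0] at h
  have h' : (n - k).choose k * k ≤ (n - k).choose (k - 1) * n :=
    h.le.trans (Nat.mul_le_mul_left _ (by lia))
  have h'' : ((n - k).choose k : ℝ) * k ≤ (n - k).choose (k - 1) * n := by exact_mod_cast h'
  rw [overlapProb, overlapProb, ← mul_div_assoc, div_le_div_iff_of_pos_right p1]
  simp only [Nat.choose_zero_right, Nat.cast_one, one_mul, Nat.sub_zero, Nat.choose_one_right]
  rw [div_mul_eq_mul_div, div_le_iff₀ hn]
  have : (0 : ℝ) ≤ k := by positivity
  nlinarith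

/-- The quantity `k ^ (5 / 2) / n`, the scale on which the relative variance is measured. -/
noncomputable def scale (n k : ℕ) : ℝ := (k : ℝ) ^ (5 / 2 : ℝ) / n

lemma scale_nonneg (n k : ℕ) : 0 ≤ scale n k := by unfold scale; positivity

lemma scale_eq (n k : ℕ) : scale n k = (k : ℝ) ^ 2 / n * √k := by
  have : (k : ℝ) ^ (5 / 2 : ℝ) = (k : ℝ) ^ 2 * √k := by
    rw [Real.sqrt_eq_rpow, show (5 / 2 : ℝ) = ((2 : ℕ) : ℝ) + 1 / 2 by norm_num,
      Real.rpow_add' (by positivity) (by norm_num), Real.rpow_natCast]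
  rw [scale, this]; ring

lemma overlapProb_mul_overlapGain_le {n k j : ℕ} (hk : k ≤ n) (hn : 0 < n) (hj : j ≤ k) :
    overlapProb n k j * overlapGain (k - j) j ≤ scale n k ^ j / √j.factorial := by
  have h1 := overlapProb_le hk hn hj
  have h2 := overlapGain_sq_le (k - j) j
  rw [Nat.sub_add_cancel hj] at h2
  have h3 : overlapGain (k - j) j ≤ √j.factorial * √k ^ j := by
    refine abs_le_of_sq_le_sq' ?_ (by positivity) |>.2
    refine h2.trans (le_of_eq ?_)
    rw [mul_pow, Real.sq_sqrt (by positivity), ← pow_mul, mul_comm j 2, pow_mul,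
      Real.sq_sqrt (by positivity)]
  have hf : √(j.factorial : ℝ) ≠ 0 := by positivity
  calc overlapProb n k j * overlapGain (k - j) j
      ≤ (((k : ℝ) ^ 2 / n) ^ j / j.factorial) * (√j.factorial * √k ^ j) :=
        mul_le_mul h1 h3 (overlapGain_pos _ _).le (by positivity)
    _ = scale n k ^ j * (√j.factorial / j.factorial) := by rw [scale_eq, mul_pow]; ring
    _ = _ := by rw [Real.sqrt_div_self', one_div, div_eq_mul_inv]

/-- Upper bound for the relative variance; the `j = 0` term of the exact formula is at most one. -/
lemma varZ_div_le {n k : ℕ} (hk : k ≤ n) (hn : 0 < n) :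
    varZ n k / meanZ n k ^ 2 ≤
      ∑ j ∈ Finset.range k, scale n k ^ (j + 1) / √(j + 1).factorial := by
  rw [varZ_div_meanZ_sq hk, Finset.sum_range_succ', Nat.sub_zero, overlapGain_zero_right, mul_one]
  have h1 : ∑ j ∈ Finset.range k, overlapProb n k (j + 1) * overlapGain (k - (j + 1)) (j + 1) ≤
      ∑ j ∈ Finset.range k, scale n k ^ (j + 1) / √(j + 1).factorial :=
    Finset.sum_le_sum fun j hj =>
      overlapProb_mul_overlapGain_le hk hn (by have := Finset.mem_range.1 hj; lia)
  have h2 := overlapProb_zero_le_one hk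
  linarith

/-- Lower bound for the relative variance, from the terms with at most one common element. -/
lemma le_varZ_div {n k : ℕ} (hk : 4 * k ≤ n) (hn : 0 < n) :
    Real.exp (-(4 * (k : ℝ) ^ 2 / n)) * (1 + scale n k / √5) - 1 ≤
      varZ n k / meanZ n k ^ 2 := by
  rw [varZ_div_meanZ_sq (by lia), Finset.sum_range_succ', Nat.sub_zero, overlapGain_zero_right,
    mul_one]
  have h0 := exp_le_overlapProb_zero hk hn
  have e0 : 0 < Real.exp (-(4 * (k : ℝ) ^ 2 / n)) := Real.exp_pos _
  suffices h : Real.exp (-(4 * (k : ℝ) ^ 2 / n)) * (scale n k / √5) ≤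
      ∑ j ∈ Finset.range k, overlapProb n k (j + 1) * overlapGain (k - (j + 1)) (j + 1) by
    linarith
  have hterm : ∀ j ∈ Finset.range k,
      0 ≤ overlapProb n k (j + 1) * overlapGain (k - (j + 1)) (j + 1) := fun j _ =>
    mul_nonneg (overlapProb_nonneg _ _ _) (overlapGain_pos _ _).le
  rcases Nat.eq_zero_or_pos k with rfl | hk0
  · simp [scale]
  · refine le_trans ?_ (Finset.single_le_sum hterm (Finset.mem_range.2 hk0))
    have h1 := mul_overlapProb_zero_le (show 2 * k ≤ n by lia) hk0
    have h2 : √k / √5 ≤ overlapGain (k - 1) 1 := by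
      rw [← Real.sqrt_div' _ (by norm_num), Real.sqrt_le_left (overlapGain_pos _ _).le]
      refine le_trans ?_ (le_overlapGain_one_sq (k - 1))
      rw [Nat.cast_sub hk0]
      push_cast
      gcongr
      linarith
    calc Real.exp (-(4 * (k : ℝ) ^ 2 / n)) * (scale n k / √5)
        = ((k : ℝ) ^ 2 / n * Real.exp (-(4 * (k : ℝ) ^ 2 / n))) * (√k / √5) := by
          rw [scale_eq]; ring
      _ ≤ ((k : ℝ) ^ 2 / n * overlapProb n k 0) * (√k / √5) := by gcongr
      _ ≤ overlapProb n k 1 * overlapGain (k - 1) 1 :=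
        mul_le_mul h1 h2 (by positivity) (overlapProb_nonneg _ _ _)

lemma varZ_div_le_two_mul {n k : ℕ} (hk : k ≤ n) (hn : 0 < n) (hs : scale n k ≤ 1 / 2) :
    varZ n k / meanZ n k ^ 2 ≤ 2 * scale n k := by
  have h0 := scale_nonneg n k
  have h1 : ∀ j ∈ Finset.range k, scale n k ^ (j + 1) / √(j + 1).factorial ≤
      scale n k * (1 / 2) ^ j := by
    intro j _
    have hf : (1 : ℝ) ≤ √((j + 1).factorial : ℝ) :=
      Real.one_le_sqrt.2 (by exact_mod_cast Nat.one_le_iff_ne_zero.2 (Nat.factorial_ne_zero _))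
    refine (div_le_self (by positivity) hf).trans ?_
    rw [pow_succ']
    gcongr
  refine (varZ_div_le hk hn).trans ((Finset.sum_le_sum h1).trans ?_)
  rw [← Finset.mul_sum, mul_comm]
  gcongr
  exact sum_geometric_two_le k

/-- The weight `1 / √(j!)` makes the bounding series converge for every `y`, not only for
`y < 1`. -/
lemma varZ_div_le_exp {n k : ℕ} (hk : k ≤ n) (hn : 0 < n) {y : ℝ} (hs : scale n k ≤ y) :
    varZ n k / meanZ n k ^ 2 ≤ Real.exp (2 * y ^ 2) + 1 := by
  have h0 := scale_nonneg n k
  have hy : 0 ≤ y := h0.trans hs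
  have h1 : ∀ j : ℕ, y ^ j / √j.factorial ≤
      1 / 2 * ((2 * y ^ 2) ^ j / j.factorial) + 1 / 2 * (1 / 2) ^ j := by
    intro j
    -- The term is a geometric mean of an exponential-series term and a geometric-series term.
    set w := √((1 / 2 : ℝ) ^ j) with hw
    set v := √((2 * y ^ 2) ^ j / j.factorial) with hv
    have e : y ^ j / √j.factorial = v * w := by
      rw [hv, hw, ← Real.sqrt_mul (by positivity), div_mul_eq_mul_div, ← mul_pow,
        Real.sqrt_div (by positivity)]
      congr 1
      rw [show 2 * y ^ 2 * (1 / 2) = y ^ 2 by ring, ← pow_mul, mul_comm 2 j, pow_mul,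
        Real.sqrt_sq (by positivity)]
    have e1 : v ^ 2 = (2 * y ^ 2) ^ j / j.factorial := Real.sq_sqrt (by positivity)
    have e2 : w ^ 2 = (1 / 2 : ℝ) ^ j := Real.sq_sqrt (by positivity)
    rw [e, ← e1, ← e2]
    nlinarith [sq_nonneg (v - w)]
  calc varZ n k / meanZ n k ^ 2
      ≤ ∑ j ∈ Finset.range k, scale n k ^ (j + 1) / √(j + 1).factorial := varZ_div_le hk hn
    _ ≤ ∑ j ∈ Finset.range k, y ^ (j + 1) / √(j + 1).factorial := by gcongr
    _ ≤ ∑ j ∈ Finset.range (k + 1), y ^ j / √j.factorial := by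
        rw [Finset.sum_range_succ']
        simp
    _ ≤ ∑ j ∈ Finset.range (k + 1),
          (1 / 2 * ((2 * y ^ 2) ^ j / j.factorial) + 1 / 2 * (1 / 2) ^ j) :=
        Finset.sum_le_sum fun j _ => h1 j
    _ ≤ 1 / 2 * Real.exp (2 * y ^ 2) + 1 / 2 * 2 := by
        rw [Finset.sum_add_distrib, ← Finset.mul_sum, ← Finset.mul_sum]
        gcongr
        · exact Real.sum_le_exp_of_nonneg (by positivity) _
        · exact sum_geometric_two_le _
    _ ≤ _ := by linarith [Real.exp_pos (2 * y ^ 2)]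

lemma scale_eq_rpow {n : ℕ} (k : ℕ) :
    scale n k = ((k : ℝ) / (n : ℝ) ^ (2 / 5 : ℝ)) ^ (5 / 2 : ℝ) := by
  rw [Real.div_rpow (by positivity) (by positivity), ← Real.rpow_mul (by positivity), scale]
  norm_num

lemma eventually_mul_le {k : ℕ → ℕ} {a : ℝ} (ha : a < 1)
    (hk : (fun n : ℕ => (k n : ℝ)) =O[atTop] (fun n : ℕ => (n : ℝ) ^ a)) :
    ∀ᶠ n : ℕ in atTop, 4 * k n ≤ n := by
  have h1 : (fun n : ℕ => (n : ℝ) ^ a) =o[atTop] (fun n : ℕ => (n : ℝ)) := by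
    have h2 := (tendsto_rpow_neg_atTop (sub_pos.2 ha)).comp (tendsto_natCast_atTop_atTop (R := ℝ))
    refine (isLittleO_iff_tendsto' ?_).2 (h2.congr' ?_)
    · filter_upwards [eventually_gt_atTop 0] with n hn h0
      exact absurd h0 (by positivity)
    · filter_upwards [eventually_gt_atTop 0] with n hn
      have : (0 : ℝ) < n := by exact_mod_cast hn
      rw [Function.comp_apply, neg_sub, Real.rpow_sub_one this.ne']
  filter_upwards [(hk.trans_isLittleO h1).bound (show (0 : ℝ) < 1 / 4 by norm_num)] with n hn
  simp only [Real.norm_natCast] at hn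
  have : 4 * (k n : ℝ) ≤ n := by linarith
  exact_mod_cast this

/-! ### Asymptotics -/

lemma tendsto_sq_div_of_isBigO {k : ℕ → ℕ} {a : ℝ} (ha : a < 1 / 2)
    (hk : (fun n : ℕ => (k n : ℝ)) =O[atTop] (fun n : ℕ => (n : ℝ) ^ a)) :
    Tendsto (fun n : ℕ => 4 * (k n : ℝ) ^ 2 / n) atTop (nhds 0) := by
  have h1 : Tendsto (fun n : ℕ => (n : ℝ) ^ (-(1 - 2 * a))) atTop (nhds 0) :=
    (tendsto_rpow_neg_atTop (by linarith)).comp tendsto_natCast_atTop_atTop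
  refine IsBigO.trans_tendsto ?_ h1
  have h2 : (fun n : ℕ => 4 * ((k n : ℝ) ^ 2 * (n : ℝ)⁻¹)) =O[atTop]
      (fun n : ℕ => ((n : ℝ) ^ a) ^ 2 * (n : ℝ)⁻¹) :=
    ((hk.pow 2).mul (isBigO_refl _ _)).const_mul_left 4
  refine (h2.congr' (Eventually.of_forall fun n => ?_) ?_)
  · ring
  · filter_upwards [eventually_gt_atTop 0] with n hn
    have : (0 : ℝ) < n := by exact_mod_cast hn
    rw [neg_sub, Real.rpow_sub_one this.ne', mul_comm 2 a, Real.rpow_mul this.le, Real.rpow_ofNat]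
    rfl

/-- For `k = o(n ^ (2 / 5))` the scale tends to zero. -/
lemma tendsto_scale_zero {k : ℕ → ℕ}
    (hk : (fun n : ℕ => (k n : ℝ)) =o[atTop] (fun n : ℕ => (n : ℝ) ^ (2 / 5 : ℝ))) :
    Tendsto (fun n => scale n (k n)) atTop (nhds 0) := by
  have h := hk.tendsto_div_nhds_zero.rpow_const (p := 5 / 2) (Or.inr (by norm_num))
  rw [Real.zero_rpow (by norm_num)] at h
  simpa only [scale_eq_rpow] using h

lemma scale_between {n k : ℕ} {c₁ c₂ : ℝ} (h₁ : 0 ≤ c₁) (hn : 0 < n)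
    (hl : c₁ * (n : ℝ) ^ (2 / 5 : ℝ) ≤ k) (hu : (k : ℝ) ≤ c₂ * (n : ℝ) ^ (2 / 5 : ℝ)) :
    c₁ ^ (5 / 2 : ℝ) ≤ scale n k ∧ scale n k ≤ c₂ ^ (5 / 2 : ℝ) := by
  have hn' : (0 : ℝ) < (n : ℝ) ^ (2 / 5 : ℝ) := by positivity
  rw [scale_eq_rpow]
  constructor
  · exact Real.rpow_le_rpow h₁ ((le_div_iff₀ hn').2 hl) (by norm_num)
  · exact Real.rpow_le_rpow (by positivity) ((div_le_iff₀ hn').2 hu) (by norm_num)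

end IncSubseq

theorem theorem1 :
    -- (i)
    (∀ k : ℕ → ℕ,
      (fun n : ℕ => (k n : ℝ)) =o[atTop] (fun n : ℕ => (n : ℝ) ^ (2 / 5 : ℝ)) →
      (fun n : ℕ => IncSubseq.varZ n (k n) / IncSubseq.meanZ n (k n) ^ 2)
          =O[atTop] (fun n : ℕ => (k n : ℝ) ^ (5 / 2 : ℝ) / (n : ℝ)) ∧
      (fun n : ℕ => IncSubseq.varZ n (k n))
          =o[atTop] (fun n : ℕ => IncSubseq.meanZ n (k n) ^ 2)) ∧
    -- (ii)
    (∀ c₁ c₂ : ℝ, 0 < c₁ → 0 < c₂ → ∃ c₃ c₄ : ℝ, 0 < c₃ ∧ 0 < c₄ ∧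
      ∀ k : ℕ → ℕ,
        (∀ᶠ n : ℕ in atTop, c₁ * (n : ℝ) ^ (2 / 5 : ℝ) ≤ (k n : ℝ) ∧
          (k n : ℝ) ≤ c₂ * (n : ℝ) ^ (2 / 5 : ℝ)) →
        ∀ᶠ n : ℕ in atTop,
          c₃ * IncSubseq.meanZ n (k n) ^ 2 ≤ IncSubseq.varZ n (k n) ∧
          IncSubseq.varZ n (k n) ≤ c₄ * IncSubseq.meanZ n (k n) ^ 2) ∧
    -- (iii)
    (∀ k : ℕ → ℕ,
      Tendsto (fun n : ℕ => (k n : ℝ) / (n : ℝ) ^ (2 / 5 : ℝ)) atTop atTop →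
      (fun n : ℕ => (k n : ℝ)) =O[atTop] (fun n : ℕ => (n : ℝ) ^ (1 / 2 : ℝ)) →
      Tendsto (fun n : ℕ => IncSubseq.varZ n (k n) / IncSubseq.meanZ n (k n) ^ 2)
        atTop atTop) := by
  refine ⟨fun k hk => ?_, fun c₁ c₂ h₁ h₂ => ?_, fun k hk hO => ?_⟩
  · have hs := IncSubseq.tendsto_scale_zero hk
    have hbound : ∀ᶠ n : ℕ in atTop, k n ≤ n ∧
        IncSubseq.varZ n (k n) / IncSubseq.meanZ n (k n) ^ 2 ≤ 2 * IncSubseq.scale n (k n) := by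
      filter_upwards [IncSubseq.eventually_mul_le (by norm_num) hk.isBigO, eventually_gt_atTop 0,
        hs.eventually_le_const (show (0 : ℝ) < 1 / 2 by norm_num)] with n h1 h2 h3
      exact ⟨by lia, IncSubseq.varZ_div_le_two_mul (by lia) h2 h3⟩
    constructor
    · refine IsBigO.of_bound 2 ?_
      filter_upwards [hbound] with n hn
      have h0 := IncSubseq.varZ_nonneg n (k n)
      rw [Real.norm_of_nonneg (by positivity), Real.norm_of_nonneg (by positivity)]
      exact hn.2
    · refine isLittleO_iff.2 fun c hc => ?_
      filter_upwards [hbound, hs.eventually_le_const (half_pos hc)] with n hn hc'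
      have h0 := IncSubseq.varZ_nonneg n (k n)
      have hm := pow_pos (IncSubseq.meanZ_pos hn.1) 2
      rw [Real.norm_of_nonneg h0, Real.norm_of_nonneg hm.le]
      exact (div_le_iff₀ hm).1 (hn.2.trans (by linarith))
  · set y₁ := c₁ ^ (5 / 2 : ℝ) with hy₁
    set y₂ := c₂ ^ (5 / 2 : ℝ) with hy₂
    have hy₁0 : 0 < y₁ := by positivity
    set w := y₁ / √5 with hw
    have hw0 : 0 < w := by positivity
    refine ⟨w / 2, Real.exp (2 * y₂ ^ 2) + 1, by positivity, by positivity, fun k hk => ?_⟩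
    have hO : (fun n : ℕ => (k n : ℝ)) =O[atTop] (fun n : ℕ => (n : ℝ) ^ (2 / 5 : ℝ)) := by
      refine IsBigO.of_bound c₂ ?_
      filter_upwards [hk] with n hn
      rw [Real.norm_of_nonneg (by positivity), Real.norm_of_nonneg (by positivity)]
      exact hn.2
    filter_upwards [hk, IncSubseq.eventually_mul_le (by norm_num) hO, eventually_gt_atTop 0,
      (IncSubseq.tendsto_sq_div_of_isBigO (by norm_num) hO).eventually_le_const
        (show 0 < w / (2 * (1 + w)) by positivity)] with n hn h4 hn0 hd
    obtain ⟨hs1, hs2⟩ := IncSubseq.scale_between h₁.le hn0 hn.1 hn.2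
    have hm := pow_pos (IncSubseq.meanZ_pos (show k n ≤ n by lia)) 2
    constructor
    · rw [← le_div_iff₀ hm]
      refine le_trans ?_ (IncSubseq.le_varZ_div h4 hn0)
      set d := 4 * (k n : ℝ) ^ 2 / n with hd'
      have e1 : 1 - d ≤ Real.exp (-d) := by linarith [Real.add_one_le_exp (-d)]
      have e2 : 1 + w ≤ 1 + IncSubseq.scale n (k n) / √5 := by rw [hw]; gcongr
      have e3 : Real.exp (-d) * (1 + w) ≤ Real.exp (-d) * (1 + IncSubseq.scale n (k n) / √5) := by
        gcongr
      have e4 : (1 - d) * (1 + w) ≤ Real.exp (-d) * (1 + w) := by gcongr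
      rw [le_div_iff₀ (by positivity)] at hd
      linarith
    · rw [← div_le_iff₀ hm]
      exact IncSubseq.varZ_div_le_exp (by lia) hn0 hs2
  · have hs : Tendsto (fun n => IncSubseq.scale n (k n)) atTop atTop := by
      simp only [IncSubseq.scale_eq_rpow]
      exact (tendsto_rpow_atTop (by norm_num)).comp hk
    obtain ⟨C, hC0, hC⟩ := hO.exists_pos
    have hE : 0 < Real.exp (-(4 * C ^ 2)) / √5 := by positivity
    refine tendsto_atTop_mono' _ ?_ (tendsto_atTop_add_const_right _ (-1)
      (hs.const_mul_atTop hE))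
    filter_upwards [hC.bound, IncSubseq.eventually_mul_le (by norm_num) hO,
      eventually_gt_atTop 0] with n hn h4 hn0
    refine le_trans ?_ (IncSubseq.le_varZ_div h4 hn0)
    have hn' : (0 : ℝ) < n := by exact_mod_cast hn0
    rw [Real.norm_of_nonneg (by positivity), Real.norm_of_nonneg (by positivity),
      ← Real.sqrt_eq_rpow] at hn
    have e1 : 4 * (k n : ℝ) ^ 2 / n ≤ 4 * C ^ 2 := by
      rw [div_le_iff₀ hn']
      have := pow_le_pow_left₀ (by positivity) hn 2
      rw [mul_pow, Real.sq_sqrt hn'.le] at this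
      linarith
    have e2 : Real.exp (-(4 * C ^ 2)) ≤ Real.exp (-(4 * (k n : ℝ) ^ 2 / n)) :=
      Real.exp_le_exp.2 (neg_le_neg e1)
    have h1 := IncSubseq.scale_nonneg n (k n)
    have e3 : Real.exp (-(4 * C ^ 2)) * (IncSubseq.scale n (k n) / √5) ≤
        Real.exp (-(4 * (k n : ℝ) ^ 2 / n)) * (IncSubseq.scale n (k n) / √5) := by gcongr
    have e4 := Real.exp_pos (-(4 * (k n : ℝ) ^ 2 / n))
    calc _ = Real.exp (-(4 * C ^ 2)) * (IncSubseq.scale n (k n) / √5) - 1 := by ring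
      _ ≤ _ := by linarith
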